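/- Let $k$ be a perfect field of characteristic different from $2$ and $3$, with algebraic closure $\bar k$, and let $E$ and $E'$ be elliptic curves over $k$ given by (general) Weierstrass equations; write $E=Z(F)$ with $F\in k[X,Y,Z]$ the homogeneous Weierstrass cubic. Let $\mathrm{Hess}(F)$ be the determinant of the matrix of second partial derivatives of $F$. The fibre of the Hesse pencil of $E$ at $t_0=(t:s)\in\mathbb P^1(\bar k)$ is the plane cubic $E_{t_0}=Z\bigl(tF+s\,\mathrm{Hess}(F)\bigr)$, so that $E_\infty=E$ for $\infty=(1:0)$. Denote by $E[3]$ and $E'[3]$ the $3$-torsion subgroups of $E(\bar k)$ and $E'(\bar k)$, regarded as subsets of $\mathbb P^2(\bar k)$, and by $e_3$ and $e_3'$ the Weil pairings on them. Let $\phi\colon E[3]\to E'[3]$ be a group isomorphism that respects the Weil pairings, i.e. $e_3(S,T)=e_3'(\phi(S),\phi(T))$ for all $S,T\in E[3]$. Then there exist a point $t_0\in\mathbb P^1(\bar k)$ for which $E_{t_0}$ is smooth and an invertible linear change of coordinates $\Phi$ of $\mathbb P^2$ over $\bar k$ that maps $E_{t_0}$ isomorphically onto $E'$ and satisfies $\Phi(P)=\phi(P)$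 for all $P\in E[3]$. -/

import Mathlib

open MvPolynomial
open scoped LinearAlgebra.Projectivization

noncomputable section

namespace HessePencil

/-! ### Plane curves: Hessian, Hesse pencil, linear changes of coordinates -/

section PlaneCurves

variable {K : Type*} [Field K]

/-- The Hessian of a ternary form `F`: the determinant of the matrix of its second partial
derivatives. -/
def hessian (F : MvPolynomial (Fin 3) K) : MvPolynomial (Fin 3) K :=
  (Matrix.of fun i j : Fin 3 => pderiv i (pderiv j F)).det

/-- The cubic form `t F + s Hess(F)` defining the fibre of the Hesse pencil of `F = 0` at the
point `(t : s)` of the projective line. Up to a non-zero factor it does not depend on the chosen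
homogeneous coordinates; the fibre at `∞ = (1 : 0)` is the curve `F = 0` itself. -/
def hesseFibre (F : MvPolynomial (Fin 3) K) (t : ℙ K (Fin 2 → K)) : MvPolynomial (Fin 3) K :=
  C (t.rep 0) * F + C (t.rep 1) * hessian F

/-- The plane curve `F = 0` (over an algebraically closed field) has no singular point. -/
def IsSmooth (F : MvPolynomial (Fin 3) K) : Prop :=
  ∀ v : Fin 3 → K, v ≠ 0 → eval v F = 0 → ∃ i, eval v (pderiv i F) ≠ 0

/-- The form `G(A (X, Y, Z)ᵗ)`. -/
def subst (A : Matrix (Fin 3) (Fin 3) K) (G : MvPolynomial (Fin 3) K) :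
    MvPolynomial (Fin 3) K :=
  bind₁ (fun i => ∑ j, C (A i j) * X j) G

/-- The projective transformation given by `A` maps the plane curve `F = 0` isomorphically onto
the plane curve `G = 0`: pulling the equation of the second curve back along `A` gives the
equation of the first one, up to a non-zero factor. -/
def MapsCurve (A : GL (Fin 3) K) (F G : MvPolynomial (Fin 3) K) : Prop :=
  ∃ c : K, c ≠ 0 ∧ subst (A : Matrix (Fin 3) (Fin 3) K) G = C c * F

end PlaneCurves

/-! ### Points of a Weierstrass curve in the projective plane -/

section Points

variable {K : Type*} [Field K]

/-- Homogeneous coordinates of a point: `O = (0 : 1 : 0)` and `(x, y) = (x : y : 1)`. -/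
def coords {W : WeierstrassCurve K} : W.toAffine.Point → Fin 3 → K
  | .zero => ![0, 1, 0]
  | .some x y _ => ![x, y, 1]

theorem coords_ne_zero {W : WeierstrassCurve K} (P : W.toAffine.Point) : coords P ≠ 0 := by
  cases P with
  | zero => intro h; simpa [coords] using congrFun h 1
  | some x y h => intro h; simpa [coords] using congrFun h 2

/-- The point of the projective plane given by a point of a Weierstrass curve. -/
def toPlane {W : WeierstrassCurve K} (P : W.toAffine.Point) : ℙ K (Fin 3 → K) :=
  Projectivization.mk K (coords P) (coords_ne_zero P)

/-- The homogeneous cubic equation `Y²Z + a₁XYZ + a₃YZ² = X³ + a₂X²Z + a₄XZ² + a₆Z³` of a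
Weierstrass curve. -/
abbrev form (W : WeierstrassCurve K) : MvPolynomial (Fin 3) K :=
  WeierstrassCurve.Projective.polynomial W.toProjective

end Points

/-! ### Divisors of rational functions and the Weil pairing -/

section WeilPairing

variable {K : Type*} [Field K]

/-- The homogeneous ideal of the point of the projective plane with homogeneous coordinates `p`,
generated by the linear forms that vanish at it. -/
def pointIdeal (p : Fin 3 → K) : Ideal (MvPolynomial (Fin 3) K) :=
  Ideal.span {f | ∃ i j, f = C (p i) * X j - C (p j) * X i}

/-- The form `G` vanishes to order at least `n` at the point `p` of the plane curve `F = 0`: in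
the local ring of the curve at `p`, the function given by `G` lies in the `n`-th power of the
maximal ideal. Clearing denominators, some `H` with `H(p) ≠ 0` has `H G ∈ (F) + I_p ^ n`. -/
def VanishesToOrder (F : MvPolynomial (Fin 3) K) (p : Fin 3 → K) (n : ℕ)
    (G : MvPolynomial (Fin 3) K) : Prop :=
  ∃ H : MvPolynomial (Fin 3) K, eval p H ≠ 0 ∧ H * G ∈ Ideal.span {F} ⊔ pointIdeal p ^ n

/-- The form `G` has order of vanishing exactly `n` at the point `p` of the curve `F = 0`. -/
def HasOrder (F : MvPolynomial (Fin 3) K) (p : Fin 3 → K) (n : ℕ)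
    (G : MvPolynomial (Fin 3) K) : Prop :=
  VanishesToOrder F p n G ∧ ¬ VanishesToOrder F p (n + 1) G

/-- The quotient `G / H` of two forms of the same degree is a non-zero rational function on the
Weierstrass curve `W` (over an algebraically closed field) with divisor `D`. -/
def HasDivisor (W : WeierstrassCurve K) (G H : MvPolynomial (Fin 3) K)
    (D : W.toAffine.Point →₀ ℤ) : Prop :=
  (∃ d : ℕ, G.IsHomogeneous d ∧ H.IsHomogeneous d) ∧
    ∀ P : W.toAffine.Point, ∃ m n : ℕ,
      HasOrder (form W) (coords P) m G ∧ HasOrder (form W) (coords P) n H ∧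
        D P = (m : ℤ) - (n : ℤ)

/-- The value `∏ (G / H)(P) ^ (D P)` of the rational function `G / H` at the divisor `D`. -/
def evalDivisor {W : WeierstrassCurve K} (G H : MvPolynomial (Fin 3) K)
    (D : W.toAffine.Point →₀ ℤ) : K :=
  D.prod fun P n => (eval (coords P) G / eval (coords P) H) ^ n

/-- `D` is a divisor of degree zero whose points sum to `S` in the group of points; equivalently,
`D` is linearly equivalent to `(S) - (O)`. -/
def SumsTo [DecidableEq K] {W : WeierstrassCurve K} (D : W.toAffine.Point →₀ ℤ)
    (S : W.toAffine.Point) : Prop :=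
  (D.sum fun _ n => n) = 0 ∧ (D.sum fun P n => n • P) = S

/-- `ζ` is the value `e₃(S, T)` of the Weil pairing on the `3`-torsion of the elliptic curve `W`
over an algebraically closed field: `ζ = f_S(D_T) / f_T(D_S)`, where `D_S` and `D_T` are divisors
of degree zero with disjoint supports that sum to `S` and `T`, and `f_S`, `f_T` are rational
functions with `div f_S = 3 D_S` and `div f_T = 3 D_T`. The functions are written as quotients
`G / H` of forms for which `H` has no zero in the support at which the function is evaluated;
since the function has neither zeros nor poles there, it can be so written. -/
def IsWeilPairingValue [DecidableEq K] (W : WeierstrassCurve K) (S T : W.toAffine.Point)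
    (ζ : K) : Prop :=
  ∃ (DS DT : W.toAffine.Point →₀ ℤ) (GS HS GT HT : MvPolynomial (Fin 3) K),
    SumsTo DS S ∧ SumsTo DT T ∧ Disjoint DS.support DT.support ∧
    HasDivisor W GS HS ((3 : ℤ) • DS) ∧ HasDivisor W GT HT ((3 : ℤ) • DT) ∧
    (∀ P ∈ DT.support, eval (coords P) HS ≠ 0) ∧
    (∀ P ∈ DS.support, eval (coords P) HT ≠ 0) ∧
    ζ = evalDivisor GS HS DT / evalDivisor GT HT DS

/-- The `3`-torsion subgroup `E[3]` of the group of points. -/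
abbrev threeTorsion [DecidableEq K] (W : WeierstrassCurve K) : AddSubgroup W.toAffine.Point :=
  AddSubgroup.torsionBy W.toAffine.Point 3

/-- The isomorphism `φ` respects the Weil pairings: `e₃(S, T) = e₃'(φ(S), φ(T))` for all `S`, `T`.
(The value of the Weil pairing does not depend on the choice of divisors and functions through
which it is computed.) -/
def RespectsWeilPairings [DecidableEq K] {W W' : WeierstrassCurve K}
    (φ : threeTorsion W ≃+ threeTorsion W') : Prop :=
  ∀ (S T : threeTorsion W) (ζ ζ' : K),
    IsWeilPairingValue W S T ζ → IsWeilPairingValue W' (φ S) (φ T) ζ' → ζ = ζ'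

end WeilPairing

end HessePencil

end

/-! Let S, T be independent points of E[3] and ω = e₃(S, T). Over an algebraically closed field of
characteristic not 2 or 3, a linear change of coordinates A brings E into Hesse form X³ + Y³ + Z³ =
3lXYZ and places O, S, T at (0 : 1 : -ω²), (0 : -ω² : 1), (1 : 0 : -ω) (`IsFlex.exists_hesseForm`).
These positions depend on ω alone. As φ respects the pairings, a matrix A' puts E' into Hesse form,
with some parameter l', and places O, φ(S), φ(T) at the same three points. The required map is Φ =
A'⁻¹A.

The Hessian is covariant, and the Hesse pencil of a smooth Hesse cubic contains every Hesse cubic,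
so Φ maps a fibre of the pencil of E onto E' (`exists_hesseFibre`); smoothness is inherited from E'.
In Hesse coordinates E[3] lies on XYZ = 0, hence on every fibre, so Φ sends E[3] into E'. Since Φ
preserves lines and three distinct collinear points of E' sum to zero, the agreement of Φ with φ
spreads from O, S, T to all of E[3] (`exists_mulVec_eq_neg_add`, `threeTorsion_induction`).

The pairing enters through flex tangents: the tangent at a 3-torsion point P cuts out the divisor
3(P), which makes e₃(S, T) an explicit expression in two flexes and their slopes
(`IsFlex.isWeilPairingValue`). -/

noncomputable section

namespace HessePencil

/-! ### Affine flexes and 3-torsion points -/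

section Flex

variable {K : Type*} [Field K] {W : WeierstrassCurve K} {x y m : K}

/-- The affine point `(x, y)` of `W` is a flex, and its tangent has slope `m`. -/
structure IsFlex (W : WeierstrassCurve K) (x y m : K) : Prop where
  equation : y ^ 2 + W.a₁ * x * y + W.a₃ * y = x ^ 3 + W.a₂ * x ^ 2 + W.a₄ * x + W.a₆
  ne : 2 * y + W.a₁ * x + W.a₃ ≠ 0
  slope : m * (2 * y + W.a₁ * x + W.a₃) = 3 * x ^ 2 + 2 * W.a₂ * x + W.a₄ - W.a₁ * y
  flex : m ^ 2 + W.a₁ * m - W.a₂ = 3 * x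

theorem IsFlex.neg (h : IsFlex W x y m) :
    IsFlex W x (-y - W.a₁ * x - W.a₃) (-m - W.a₁) where
  equation := by linear_combination h.equation
  ne := fun h' => h.ne (by linear_combination -h')
  slope := by linear_combination h.slope
  flex := by linear_combination h.flex

/-- The linear form of the line of slope `m` through `(x, y)`. -/
def lineForm (x y m : K) : MvPolynomial (Fin 3) K :=
  X 1 - C y * X 2 - C m * (X 0 - C x * X 2)

@[simp]
theorem eval_lineForm (p : Fin 3 → K) :
    eval p (lineForm x y m) = p 1 - y * p 2 - m * (p 0 - x * p 2) := by
  simp [lineForm]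

theorem lineForm_isHomogeneous : (lineForm x y m).IsHomogeneous 1 := by
  have hX (i : Fin 3) : (X i : MvPolynomial (Fin 3) K).IsHomogeneous 1 := isHomogeneous_X _ _
  have hC (a : K) {f : MvPolynomial (Fin 3) K} (hf : f.IsHomogeneous 1) :
      (C a * f).IsHomogeneous 1 := by
    simpa using (isHomogeneous_C (Fin 3) a).mul hf
  exact ((hX 1).sub (hC _ (hX 2))).sub (hC _ ((hX 0).sub (hC _ (hX 2))))

/-- The three defining conditions cancel the terms of degree 0, 1 and 2 in X - xZ along the tangent.
What remains is F = Z L L' - (X - xZ)³, where Z, L, L' are the tangents at the collinear flexes O,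
P, -P. -/
theorem IsFlex.eval_form (h : IsFlex W x y m) (p : Fin 3 → K) :
    eval p (form W) = p 2 * (p 1 - y * p 2 - m * (p 0 - x * p 2)) *
      (p 1 + y * p 2 + W.a₃ * p 2 + W.a₁ * p 0 + m * (p 0 - x * p 2)) - (p 0 - x * p 2) ^ 3 := by
  rw [form, WeierstrassCurve.Projective.eval_polynomial]
  have h1 := h.equation
  have h2 := h.slope
  have h3 := h.flex
  linear_combination (p 2)^3 * h1 + (p 2)^2 * (p 0 - x * p 2) * h2 + p 2 * (p 0 - x * p 2)^2 * h3

theorem IsFlex.form_eq (h : IsFlex W x y m) :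
    form W = X 2 * lineForm x y m * lineForm x (-y - W.a₁ * x - W.a₃) (-m - W.a₁) -
      (X 0 - C x * X 2) ^ 3 := by
  have hn2 : (C 2 : MvPolynomial (Fin 3) K) = 2 := map_ofNat C 2
  have hn3 : (C 3 : MvPolynomial (Fin 3) K) = 3 := map_ofNat C 3
  have h1 := congrArg (C (σ := Fin 3)) h.equation
  have h2 := congrArg (C (σ := Fin 3)) h.slope
  have h3 := congrArg (C (σ := Fin 3)) h.flex
  rw [form, WeierstrassCurve.Projective.polynomial, lineForm, lineForm]
  simp only [C_add, C_sub, C_mul, C_pow, C_neg, hn2, hn3] at h1 h2 h3 ⊢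
  linear_combination (X 2)^3 * h1 + (X 2)^2 * (X 0 - C x * X 2) * h2 +
    X 2 * (X 0 - C x * X 2)^2 * h3

theorem eval_form_coords (P : W.toAffine.Point) : eval (coords P) (form W) = 0 := by
  rw [form, WeierstrassCurve.Projective.eval_polynomial]
  cases P with
  | zero => simp [coords]
  | some x y h =>
    have := (W.toAffine.equation_iff x y).1 h.1
    simp only [coords]
    simp
    linear_combination this

/-- The curve meets the tangent at a flex only there. -/
theorem IsFlex.coords_eq (h : IsFlex W x y m) {P : W.toAffine.Point}
    (hP : eval (coords P) (lineForm x y m) = 0) : ∃ hxy, P = .some x y hxy := by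
  have hF := h.eval_form (coords P)
  rw [eval_form_coords] at hF
  rw [eval_lineForm] at hP
  rw [hP] at hF
  cases P with
  | zero => simp [coords] at hP
  | some x' y' h' =>
    have hx : x' - x = 0 := by
      simpa [coords] using hF
    obtain rfl : x' = x := sub_eq_zero.1 hx
    obtain rfl : y' = y := sub_eq_zero.1 (by simpa [coords] using hP)
    exact ⟨h', rfl⟩

/-- If the tangent has slope m = N/D, the right side is -D²(m² + a₁m - a₂ - 3x), so the roots of Ψ₃
detect flexes. -/
theorem eval_Ψ₃_eq
    (h : y ^ 2 + W.a₁ * x * y + W.a₃ * y = x ^ 3 + W.a₂ * x ^ 2 + W.a₄ * x + W.a₆) :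
    W.Ψ₃.eval x = (W.a₂ + 3 * x) * (2 * y + W.a₁ * x + W.a₃) ^ 2 -
      (3 * x ^ 2 + 2 * W.a₂ * x + W.a₄ - W.a₁ * y) ^ 2 -
      W.a₁ * (3 * x ^ 2 + 2 * W.a₂ * x + W.a₄ - W.a₁ * y) * (2 * y + W.a₁ * x + W.a₃) := by
  simp only [WeierstrassCurve.Ψ₃, WeierstrassCurve.b₂, WeierstrassCurve.b₄, WeierstrassCurve.b₆,
    WeierstrassCurve.b₈, Polynomial.eval_add, Polynomial.eval_mul, Polynomial.eval_pow,
    Polynomial.eval_C, Polynomial.eval_X, Polynomial.eval_ofNat]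
  linear_combination -(W.a₁ ^ 2 + 4 * W.a₂ + 12 * x) * h

theorem IsFlex.eval_Ψ₃ (h : IsFlex W x y m) : W.Ψ₃.eval x = 0 := by
  rw [eval_Ψ₃_eq h.equation, ← h.slope]
  linear_combination -(2 * y + W.a₁ * x + W.a₃) ^ 2 * h.flex

theorem exists_isFlex (h : W.Ψ₃.eval x = 0) (hxy : W.toAffine.Nonsingular x y) :
    ∃ m, IsFlex W x y m := by
  obtain ⟨heq, hns⟩ := (W.toAffine.nonsingular_iff' x y).1 hxy
  rw [W.toAffine.equation_iff] at heq
  rw [eval_Ψ₃_eq heq] at h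
  -- With a vertical tangent, Ψ₃(x) = 0 would make both partial derivatives vanish.
  have hne : 2 * y + W.a₁ * x + W.a₃ ≠ 0 := by
    intro h0
    rw [h0] at h hns
    have : 3 * x ^ 2 + 2 * W.a₂ * x + W.a₄ - W.a₁ * y = 0 := by simpa using h
    refine hns.elim (fun h' => h' ?_) (fun h' => h' rfl)
    linear_combination -this
  obtain ⟨m, hm⟩ : ∃ m, m * (2 * y + W.a₁ * x + W.a₃) =
      3 * x ^ 2 + 2 * W.a₂ * x + W.a₄ - W.a₁ * y := ⟨_, div_mul_cancel₀ _ hne⟩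
  refine ⟨m, heq, hne, hm, mul_right_cancel₀ (pow_ne_zero 2 hne) ?_⟩
  rw [← hm] at h
  linear_combination -h

variable [DecidableEq K]

theorem three_smul_eq_zero_iff {P : W.toAffine.Point} :
    P ∈ threeTorsion W ↔ P + P = -P := by
  rw [show P ∈ threeTorsion W ↔ (3 : ℤ) • P = 0 from Iff.rfl, eq_neg_iff_add_eq_zero,
    show (3 : ℤ) • P = P + P + P by abel]

/-- The tangent meets the curve again at abscissa m² + a₁m - a₂ - 2x, and P + P = -P says that this
is x. The condition `ne` rules out 2-torsion. -/
theorem some_mem_threeTorsion_iff {hxy : W.toAffine.Nonsingular x y} :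
    (.some x y hxy : W.toAffine.Point) ∈ threeTorsion W ↔ ∃ m, IsFlex W x y m := by
  have heq := (W.toAffine.equation_iff x y).1 hxy.1
  rw [three_smul_eq_zero_iff]
  by_cases hy : y = W.toAffine.negY x y
  · rw [WeierstrassCurve.Affine.Point.add_self_of_Y_eq hy]
    constructor
    · intro h
      exact absurd (neg_eq_zero.1 h.symm) (WeierstrassCurve.Affine.Point.some_ne_zero hxy)
    · rintro ⟨m, hm⟩
      rw [WeierstrassCurve.Affine.negY] at hy
      exact absurd (by linear_combination hy) hm.ne
  · have hne : 2 * y + W.a₁ * x + W.a₃ ≠ 0 := fun h => hy (by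
      rw [WeierstrassCurve.Affine.negY]; linear_combination h)
    have hne' : y - W.toAffine.negY x y ≠ 0 := sub_ne_zero.2 hy
    rw [WeierstrassCurve.Affine.Point.add_self_of_Y_ne hy, WeierstrassCurve.Affine.Point.neg_some,
      WeierstrassCurve.Affine.Point.some.injEq]
    have hsl := W.toAffine.slope_of_Y_ne rfl hy
    set ℓ := W.toAffine.slope x x y y
    rw [eq_div_iff hne'] at hsl
    rw [WeierstrassCurve.Affine.addY, WeierstrassCurve.Affine.negAddY,
      WeierstrassCurve.Affine.addX]
    simp only [WeierstrassCurve.Affine.negY] at hsl ⊢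
    constructor
    · rintro ⟨h, -⟩
      exact ⟨ℓ, heq, hne, by linear_combination hsl, by linear_combination h⟩
    · rintro ⟨m, hm⟩
      have hmℓ : m = ℓ := by
        apply mul_right_cancel₀ hne
        linear_combination hm.slope - hsl
      have : ℓ ^ 2 + W.a₁ * ℓ - W.a₂ - x - x = x := by
        rw [← hmℓ]; linear_combination hm.flex
      refine ⟨this, ?_⟩
      rw [this]
      ring

end Flex

/-! ### Orders of vanishing and divisors of flex tangents -/

section Order

variable {K : Type*} [Field K]

/-- An arc `c` through `p` that lies on `F = 0` up to order `n` bounds orders of vanishing. -/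
theorem not_vanishesToOrder_of_arc {F G : MvPolynomial (Fin 3) K} {p : Fin 3 → K} {n : ℕ}
    (c : Fin 3 → Polynomial K) (hc : ∀ i, (c i).eval 0 = p i)
    (hF : Polynomial.X ^ n ∣ aeval c F) (hG : ¬ Polynomial.X ^ n ∣ aeval c G) :
    ¬ VanishesToOrder F p n G := by
  rintro ⟨H, hH, hmem⟩
  have heval (f : MvPolynomial (Fin 3) K) : (aeval c f).eval 0 = eval p f := by
    rw [← Polynomial.coe_evalRingHom, ← coe_aeval_eq_eval, ← funext hc]
    change ((Polynomial.evalRingHom 0).comp (aeval c).toRingHom) f = _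
    congr 1
    ext <;> simp
  have hI : pointIdeal p ≤ (Ideal.span {Polynomial.X}).comap (aeval c : _ →ₐ[K] Polynomial K) := by
    rw [pointIdeal, Ideal.span_le]
    rintro _ ⟨i, j, rfl⟩
    rw [SetLike.mem_coe, Ideal.mem_comap, Ideal.mem_span_singleton, Polynomial.X_dvd_iff,
      Polynomial.coeff_zero_eq_eval_zero, heval]
    simp [mul_comm]
  have hle : Ideal.span {F} ⊔ pointIdeal p ^ n ≤
      (Ideal.span {Polynomial.X ^ n}).comap (aeval c : _ →ₐ[K] Polynomial K) := by
    refine sup_le ?_ ?_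
    · rw [Ideal.span_singleton_le_iff_mem, Ideal.mem_comap, Ideal.mem_span_singleton]
      exact hF
    · rw [← Ideal.span_singleton_pow]
      exact (Ideal.pow_right_mono hI n).trans (Ideal.le_comap_pow _ n)
  have := hle hmem
  rw [Ideal.mem_comap, Ideal.mem_span_singleton, map_mul] at this
  -- H(p) ≠ 0 makes H along the arc prime to the parameter, so the whole power divides G.
  refine hG (Polynomial.prime_X.pow_dvd_of_dvd_mul_left n ?_ this)
  rwa [Polynomial.X_dvd_iff, Polynomial.coeff_zero_eq_eval_zero, heval]

theorem hasOrder_zero {F G : MvPolynomial (Fin 3) K} {p : Fin 3 → K} (hF : eval p F = 0)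
    (hG : eval p G ≠ 0) : HasOrder F p 0 G := by
  have haeval (f : MvPolynomial (Fin 3) K) :
      aeval (fun i => Polynomial.C (p i)) f = Polynomial.C (eval p f) := by
    rw [← coe_aeval_eq_eval, ← Polynomial.algebraMap_eq]
    exact (aeval_algebraMap_apply _ p f)
  refine ⟨⟨1, by simp, by simp⟩, not_vanishesToOrder_of_arc (fun i => Polynomial.C (p i))
    (by simp) ?_ ?_⟩
  · rw [haeval, hF]
    simp
  · rw [haeval, zero_add, pow_one, Polynomial.X_dvd_iff]
    simpa using hG

variable {W : WeierstrassCurve K} {x y m : K}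

theorem IsFlex.hasOrder_lineForm (h : IsFlex W x y m) :
    HasOrder (form W) ![x, y, 1] 3 (lineForm x y m) := by
  constructor
  · refine ⟨X 2 * lineForm x (-y - W.a₁ * x - W.a₃) (-m - W.a₁), ?_, ?_⟩
    · simp only [map_mul, eval_X, eval_lineForm]
      intro h0
      apply h.ne
      simp at h0
      linear_combination h0
    · rw [show X 2 * lineForm x (-y - W.a₁ * x - W.a₃) (-m - W.a₁) * lineForm x y m =
        form W + (X 0 - C x * X 2) ^ 3 by rw [h.form_eq]; ring]
      refine add_mem (Ideal.mem_sup_left (Ideal.mem_span_singleton_self _))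
        (Ideal.mem_sup_right (Ideal.pow_mem_pow ?_ 3))
      exact Ideal.subset_span ⟨2, 0, by simp⟩
  · set β := 2 * y + W.a₁ * x + W.a₃ with hβ
    -- Along this arc L = β⁻¹s³ and L' = β + O(s), so F = L L' - s³ vanishes to order 4 while L has
    -- order exactly 3.
    let c : Fin 3 → Polynomial K := ![Polynomial.C x + Polynomial.X,
      Polynomial.C y + Polynomial.C m * Polynomial.X + Polynomial.C β⁻¹ * Polynomial.X ^ 3, 1]
    have hβ0 : Polynomial.C β * Polynomial.C β⁻¹ = 1 := by
      rw [← Polynomial.C_mul, mul_inv_cancel₀ h.ne, Polynomial.C_1]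
    have hC2 : (Polynomial.C 2 : Polynomial K) = 2 := Polynomial.C_ofNat 2
    have hl : aeval c (lineForm x y m) = Polynomial.C β⁻¹ * Polynomial.X ^ 3 := by
      simp only [lineForm, map_sub, map_mul, aeval_X, ← algebraMap_eq]
      simp [c]
      ring
    have hl' : aeval c (lineForm x (-y - W.a₁ * x - W.a₃) (-m - W.a₁)) = Polynomial.C β +
        Polynomial.X * Polynomial.C (2 * m + W.a₁) + Polynomial.C β⁻¹ * Polynomial.X ^ 3 := by
      simp only [lineForm, map_sub, map_mul, aeval_X, ← algebraMap_eq]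
      simp [c, hβ, hC2]
      ring
    have hu : aeval c (X 0 - C x * X 2) = Polynomial.X := by
      simp [c]
    refine not_vanishesToOrder_of_arc c ?_ ?_ ?_
    · intro i
      fin_cases i <;> simp [c]
    · rw [h.form_eq, map_sub, map_mul, map_mul, hl, hl', map_pow, hu, aeval_X]
      refine ⟨Polynomial.C β⁻¹ * Polynomial.C (2 * m + W.a₁) +
        Polynomial.C β⁻¹ ^ 2 * Polynomial.X ^ 2, ?_⟩
      simp only [c, Matrix.cons_val]
      linear_combination Polynomial.X ^ 3 * hβ0
    · rw [hl, Polynomial.X_pow_dvd_iff]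
      intro h0
      have := h0 3 (by norm_num)
      rw [Polynomial.coeff_C_mul_X_pow] at this
      simp at this
      exact h.ne this

theorem hasOrder_X_two : HasOrder (form W) ![0, 1, 0] 3 (X 2) := by
  constructor
  · refine ⟨X 1 ^ 2 + C W.a₁ * X 0 * X 1 + C W.a₃ * X 1 * X 2 - C W.a₂ * X 0 ^ 2 -
      C W.a₄ * X 0 * X 2 - C W.a₆ * X 2 ^ 2, by simp, ?_⟩
    rw [show ∀ q : MvPolynomial (Fin 3) K, q * X 2 = (q * X 2 - X 0 ^ 3) + X 0 ^ 3 by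
      intro q; ring]
    refine add_mem (Ideal.mem_sup_left (Ideal.mem_span_singleton.2 (Eq.dvd ?_)))
        (Ideal.mem_sup_right (Ideal.pow_mem_pow ?_ 3))
    · rw [form, WeierstrassCurve.Projective.polynomial]
      ring
    · exact Ideal.subset_span ⟨1, 0, by simp⟩
  -- To third order the curve near O is Z = X³ in the chart Y = 1.
  · refine not_vanishesToOrder_of_arc ![Polynomial.X, 1, Polynomial.X ^ 3] ?_ ?_ ?_
    · intro i
      fin_cases i <;> simp
    · rw [form, WeierstrassCurve.Projective.polynomial]
      simp only [map_sub, map_add, map_mul, map_pow, aeval_X, aeval_C, Matrix.cons_val,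
        Polynomial.algebraMap_eq]
      refine ⟨Polynomial.C W.a₁ + Polynomial.C W.a₃ * Polynomial.X ^ 2 -
        Polynomial.C W.a₂ * Polynomial.X - Polynomial.C W.a₄ * Polynomial.X ^ 3 -
        Polynomial.C W.a₆ * Polynomial.X ^ 5, ?_⟩
      ring
    · rw [aeval_X, Polynomial.X_pow_dvd_iff]
      intro h0
      have := h0 3 (by norm_num)
      simp at this

variable [DecidableEq K]

theorem IsFlex.hasOrder_lineForm_ite (h : IsFlex W x y m) (hxy : W.toAffine.Nonsingular x y)
    (P : W.toAffine.Point) : HasOrder (form W) (coords P)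
      (if P = .some x y hxy then 3 else 0) (lineForm x y m) := by
  split_ifs with hP
  · rw [hP]
    exact h.hasOrder_lineForm
  · refine hasOrder_zero (eval_form_coords P) fun h0 => hP ?_
    obtain ⟨_, rfl⟩ := h.coords_eq h0
    rfl

theorem hasOrder_X_two_ite (P : W.toAffine.Point) : HasOrder (form W) (coords P)
      (if P = 0 then 3 else 0) (X 2) := by
  split_ifs with hP
  · rw [hP]
    exact hasOrder_X_two
  · refine hasOrder_zero (eval_form_coords P) fun h0 => hP ?_
    cases P with
    | zero => rfl
    | some x y hxy => simp [coords] at h0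

theorem hasDivisor_of_hasOrder {G H : MvPolynomial (Fin 3) K} {S T : W.toAffine.Point}
    (hG : G.IsHomogeneous 1) (hH : H.IsHomogeneous 1)
    (hGS : ∀ P, HasOrder (form W) (coords P) (if P = S then 3 else 0) G)
    (hHT : ∀ P, HasOrder (form W) (coords P) (if P = T then 3 else 0) H) :
    HasDivisor W G H ((3 : ℤ) • (Finsupp.single S 1 - Finsupp.single T 1)) := by
  refine ⟨⟨1, hG, hH⟩, fun P => ⟨_, _, hGS P, hHT P, ?_⟩⟩
  simp only [Finsupp.smul_apply, Finsupp.sub_apply, Finsupp.single_apply, eq_comm (b := P)]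
  split_ifs <;> simp

theorem evalDivisor_single_sub_single (G H : MvPolynomial (Fin 3) K) {S T : W.toAffine.Point}
    (hST : S ≠ T) : evalDivisor G H (Finsupp.single S 1 - Finsupp.single T 1) =
      (eval (coords S) G / eval (coords S) H) / (eval (coords T) G / eval (coords T) H) := by
  rw [evalDivisor, Finsupp.prod_of_support_subset (s := {S, T}), Finset.prod_pair hST]
  · simp [hST, hST.symm, div_eq_mul_inv]
  · refine Finsupp.support_sub.trans (Finset.union_subset ?_ ?_) <;>
    exact Finsupp.support_single_subset.trans (by simp)
  · simp

theorem support_single_sub_single_subset (S T : W.toAffine.Point) :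
    (Finsupp.single S 1 - Finsupp.single T 1 : W.toAffine.Point →₀ ℤ).support ⊆ {S, T} := by
  refine Finsupp.support_sub.trans (Finset.union_subset ?_ ?_) <;>
    exact Finsupp.support_single_subset.trans (by simp)

theorem sumsTo_single_sub_single (S T : W.toAffine.Point) :
    SumsTo (Finsupp.single S 1 - Finsupp.single T 1) (S - T) := by
  constructor <;> rw [Finsupp.sum_sub_index (by intros; simp [sub_smul]), Finsupp.sum_single_index,
    Finsupp.sum_single_index] <;> simp

end Order

/-! ### The Weil pairing of two flexes -/

section WeilPairing

variable {K : Type*} [Field K] [DecidableEq K] {W : WeierstrassCurve K} {x₁ y₁ m₁ x₂ y₂ m₂ : K}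

/-- The Weil pairing of two flexes that do not lie on a line with the flex at infinity, computed
with the divisors `(S) - (O)` and `(-T) - (T)`. -/
theorem IsFlex.isWeilPairingValue (h₁ : IsFlex W x₁ y₁ m₁) (h₂ : IsFlex W x₂ y₂ m₂)
    (hS : W.toAffine.Nonsingular x₁ y₁) (hT : W.toAffine.Nonsingular x₂ y₂) (hx : x₁ ≠ x₂) :
    IsWeilPairingValue W (.some x₁ y₁ hS) (.some x₂ y₂ hT)
      (((-y₂ - W.a₁ * x₂ - W.a₃) - y₁ - m₁ * (x₂ - x₁)) / (y₂ - y₁ - m₁ * (x₂ - x₁)) /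
      ((y₁ - (-y₂ - W.a₁ * x₂ - W.a₃) - (-m₂ - W.a₁) * (x₁ - x₂)) /
        (y₁ - y₂ - m₂ * (x₁ - x₂)))) := by
  set S : W.toAffine.Point := .some x₁ y₁ hS with hSdef
  set T : W.toAffine.Point := .some x₂ y₂ hT with hTdef
  have hT' : W.toAffine.Nonsingular x₂ (-y₂ - W.a₁ * x₂ - W.a₃) :=
    (W.toAffine.nonsingular_neg x₂ y₂).2 hT
  have hnegT : -T = .some x₂ (-y₂ - W.a₁ * x₂ - W.a₃) hT' := rfl
  have hTT : -T ≠ T := by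
    rw [hnegT, hTdef]
    intro h
    rw [WeierstrassCurve.Affine.Point.some.injEq] at h
    exact h₂.ne (by linear_combination -h.2)
  have h3T : -T - T = T := by
    rw [← three_smul_eq_zero_iff.1 (some_mem_threeTorsion_iff.2 ⟨m₂, h₂⟩ :
      T ∈ threeTorsion W)]
    abel
  have hS0 : S ≠ 0 := WeierstrassCurve.Affine.Point.some_ne_zero hS
  have hST : S ≠ T := by
    rw [hSdef, hTdef]
    intro h
    rw [WeierstrassCurve.Affine.Point.some.injEq] at h
    exact hx h.1
  have hST' : S ≠ -T := by
    rw [hSdef, hnegT]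
    intro h
    rw [WeierstrassCurve.Affine.Point.some.injEq] at h
    exact hx h.1
  have hT0 : T ≠ 0 := WeierstrassCurve.Affine.Point.some_ne_zero hT
  have hT0' : -T ≠ 0 := neg_ne_zero.2 hT0
  -- (-T) - (T) sums to -2T = T and, unlike (T) - (O), is disjoint from (S) - (O).
  refine ⟨Finsupp.single S 1 - Finsupp.single 0 1, Finsupp.single (-T) 1 - Finsupp.single T 1,
    lineForm x₁ y₁ m₁, X 2, lineForm x₂ (-y₂ - W.a₁ * x₂ - W.a₃) (-m₂ - W.a₁), lineForm x₂ y₂ m₂,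
    ?_, ?_, ?_, ?_, ?_, ?_, ?_, ?_⟩
  · simpa using sumsTo_single_sub_single S 0
  · have := sumsTo_single_sub_single (-T) T
    rwa [h3T] at this
  · refine Finset.disjoint_of_subset_left (support_single_sub_single_subset _ _)
      (Finset.disjoint_of_subset_right (support_single_sub_single_subset _ _) ?_)
    simp [hST, hST', hT0, hT0', eq_comm]
  · exact hasDivisor_of_hasOrder lineForm_isHomogeneous (isHomogeneous_X _ _)
      (h₁.hasOrder_lineForm_ite hS) hasOrder_X_two_ite
  · exact hasDivisor_of_hasOrder lineForm_isHomogeneous lineForm_isHomogeneous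
      (h₂.neg.hasOrder_lineForm_ite hT') (h₂.hasOrder_lineForm_ite hT)
  · intro P hP
    have := support_single_sub_single_subset _ _ hP
    simp only [Finset.mem_insert, Finset.mem_singleton] at this
    rcases this with rfl | rfl
    · rw [hnegT]
      simp [coords]
    · simp [coords, hTdef]
  · intro P hP h0
    obtain ⟨_, hPT⟩ := h₂.coords_eq h0
    have := support_single_sub_single_subset _ _ hP
    simp only [Finset.mem_insert, Finset.mem_singleton] at this
    rcases this with rfl | rfl
    · exact hST hPT
    · exact hT0 hPT.symm
  · rw [evalDivisor_single_sub_single _ _ hTT, evalDivisor_single_sub_single _ _ hS0, hnegT,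
      hTdef, hSdef, WeierstrassCurve.Affine.Point.zero_def]
    -- Both tangent forms at ±T equal 1 at O, so f_T(O) = 1 drops out.
    simp only [coords, eval_lineForm, eval_X, Matrix.cons_val]
    simp only [mul_one, div_one, mul_zero, sub_zero]

end WeilPairing

/-! ### Reduction to Hesse form -/

section HesseForm

variable {K : Type*} [Field K]

/-- The cubic form `X³ + Y³ + Z³ - 3lXYZ`. -/
def hesseForm (l : K) : MvPolynomial (Fin 3) K :=
  X 0 ^ 3 + X 1 ^ 3 + X 2 ^ 3 - C (3 * l) * (X 0 * X 1 * X 2)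

theorem eval_hesseForm (l : K) (p : Fin 3 → K) :
    eval p (hesseForm l) = p 0 ^ 3 + p 1 ^ 3 + p 2 ^ 3 - 3 * l * (p 0 * p 1 * p 2) := by
  simp [hesseForm]

/-- The Hessian of a Hesse cubic belongs to the pencil of Hesse cubics. -/
theorem hessian_hesseForm (l : K) : hessian (hesseForm l) =
    C (-54 * l ^ 2) * (X 0 ^ 3 + X 1 ^ 3 + X 2 ^ 3) +
      C (216 - 54 * l ^ 3) * (X 0 * X 1 * X 2) := by
  have h3 : (C 3 : MvPolynomial (Fin 3) K) = 3 := map_ofNat C 3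
  have h54 : (C 54 : MvPolynomial (Fin 3) K) = 54 := map_ofNat C 54
  have h216 : (C 216 : MvPolynomial (Fin 3) K) = 216 := map_ofNat C 216
  have hd (i : Fin 3) : pderiv i (hesseForm l) = ![3 * X 0 ^ 2 - C (3 * l) * (X 1 * X 2),
      3 * X 1 ^ 2 - C (3 * l) * (X 0 * X 2), 3 * X 2 ^ 2 - C (3 * l) * (X 0 * X 1)] i := by
    fin_cases i <;> simp [hesseForm, pderiv_X] <;>
      exact Or.inl (mul_comm _ _)
  have h3' (i : Fin 3) : pderiv i (3 : MvPolynomial (Fin 3) K) = 0 := by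
    rw [← h3, pderiv_C]
  rw [hessian, Matrix.det_fin_three]
  simp only [Matrix.of_apply, hd, Matrix.cons_val]
  simp [pderiv_X, h3', h3, h54, h216]
  ring

variable {W : WeierstrassCurve K} {x₁ y₁ m₁ x₂ y₂ m₂ : K}

/-- The expression of the Weil pairing of two flexes by the tangents there. -/
def flexPairing (W : WeierstrassCurve K) (x₁ y₁ m₁ x₂ y₂ m₂ : K) : K :=
  ((-y₂ - W.a₁ * x₂ - W.a₃) - y₁ - m₁ * (x₂ - x₁)) / (y₂ - y₁ - m₁ * (x₂ - x₁)) /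
    ((y₁ - (-y₂ - W.a₁ * x₂ - W.a₃) - (-m₂ - W.a₁) * (x₁ - x₂)) /
      (y₁ - y₂ - m₂ * (x₁ - x₂)))

section Relative

variable {α β u v μ : K}

/-- Eliminating μ and then v leaves the 3-division polynomial of v² + αuv + βv = u³. -/
theorem flexPolynomial_eq_zero (h₁ : v * (v + α * u + β) = u ^ 3)
    (h₂ : μ * (2 * v + α * u + β) = 3 * u ^ 2 - α * v) (h₃ : μ ^ 2 + α * μ = 3 * u) :
    u * (3 * u ^ 3 + α ^ 2 * u ^ 2 + 3 * α * β * u + 3 * β ^ 2) = 0 := by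
  have h : (3 * u ^ 2 - α * v) ^ 2 + α * (3 * u ^ 2 - α * v) * (2 * v + α * u + β) =
      3 * u * (2 * v + α * u + β) ^ 2 := by
    rw [← h₂]
    linear_combination (2 * v + α * u + β) ^ 2 * h₃
  linear_combination -h - (α ^ 2 + 12 * u) * h₁

end Relative

/-- The coordinates u, v put the first flex at the origin with tangent v = 0, and the curve becomes
v² + αuv + βv = u³. -/
theorem IsFlex.relative (h₁ : IsFlex W x₁ y₁ m₁) (h₂ : IsFlex W x₂ y₂ m₂) {α β u v μ : K}
    (hα : α = W.a₁ + 2 * m₁) (hβ : β = 2 * y₁ + W.a₁ * x₁ + W.a₃) (hu : u = x₂ - x₁)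
    (hv : v = y₂ - y₁ - m₁ * (x₂ - x₁)) (hμ : μ = m₂ - m₁) :
    v * (v + α * u + β) = u ^ 3 ∧ μ * (2 * v + α * u + β) = 3 * u ^ 2 - α * v ∧
      μ ^ 2 + α * μ = 3 * u := by
  subst hα hβ hu hv hμ
  refine ⟨?_, ?_, ?_⟩
  · have h := h₁.eval_form ![x₂, y₂, 1]
    rw [form, WeierstrassCurve.Projective.eval_polynomial] at h
    simp only [Matrix.cons_val] at h
    linear_combination h₂.equation - h
  · linear_combination h₂.slope - h₁.slope - 2 * (x₂ - x₁) * h₁.flex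
  · linear_combination h₂.flex - h₁.flex

/-- The change of coordinates that brings `W` into Hesse form, given by two flexes. -/
def hesseMatrix (α β γ ω x₁ y₁ m₁ : K) : Matrix (Fin 3) (Fin 3) K :=
  !![γ, 0, -γ * x₁;
    α - (1 - ω) * m₁, 1 - ω, -α * x₁ + (1 - ω) * (m₁ * x₁ - y₁) + (1 - ω ^ 2) * β;
    α - (1 - ω ^ 2) * m₁, 1 - ω ^ 2, -α * x₁ + (1 - ω ^ 2) * (m₁ * x₁ - y₁) + (1 - ω) * β]

theorem hesseMatrix_mulVec (α β γ ω x₁ y₁ m₁ : K) (p : Fin 3 → K) :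
    (hesseMatrix α β γ ω x₁ y₁ m₁).mulVec p = ![γ * (p 0 - x₁ * p 2),
      α * (p 0 - x₁ * p 2) + (1 - ω) * (p 1 - y₁ * p 2 - m₁ * (p 0 - x₁ * p 2)) +
        (1 - ω ^ 2) * β * p 2,
      α * (p 0 - x₁ * p 2) + (1 - ω ^ 2) * (p 1 - y₁ * p 2 - m₁ * (p 0 - x₁ * p 2)) +
        (1 - ω) * β * p 2] := by
  ext i
  fin_cases i <;> simp [hesseMatrix, Matrix.mulVec, dotProduct, Fin.sum_univ_three] <;> ring

theorem hesseMatrix_det (α β γ x₁ y₁ m₁ : K) {ω : K} (hω : ω ^ 2 + ω + 1 = 0) :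
    (hesseMatrix α β γ ω x₁ y₁ m₁).det = γ * β * (1 - ω) ^ 3 := by
  rw [hesseMatrix, Matrix.det_fin_three]
  simp
  linear_combination -γ * β * (1 - ω) ^ 2 * hω

/-- x³ + y³ + z³ - 3xyz is the product of the forms x + ωⁱy + ω²ⁱz; here these are 3(a + b + c), -3b
and -3c. -/
theorem pencil_identity {ω : K} (hω : ω ^ 2 + ω + 1 = 0) (a b c : K) :
    (a + (1 - ω) * b + (1 - ω ^ 2) * c) ^ 3 + (a + (1 - ω ^ 2) * b + (1 - ω) * c) ^ 3 + a ^ 3 -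
      3 * a * (a + (1 - ω) * b + (1 - ω ^ 2) * c) * (a + (1 - ω ^ 2) * b + (1 - ω) * c) =
      27 * b * c * (a + b + c) := by
  grind

theorem conjugate_mul {ω : K} (hω : ω ^ 2 + ω + 1 = 0) (a b c : K) :
    (a + (1 - ω) * b + (1 - ω ^ 2) * c) * (a + (1 - ω ^ 2) * b + (1 - ω) * c) =
      a ^ 2 + 3 * a * c + 3 * c ^ 2 + 3 * b * (a + b + c) := by
  grind

theorem ne_one_of_primitive (h3 : (3 : K) ≠ 0) {ω : K} (hω : ω ^ 2 + ω + 1 = 0) : 1 - ω ≠ 0 := by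
  intro h
  apply h3
  linear_combination hω + (ω + 2) * h

/-- Every elliptic curve with two flexes that do not lie on a line with the flex at infinity has
a Hesse form, in which the coordinates of these three flexes only depend on the Weil pairing. -/
theorem IsFlex.exists_hesseForm (h3 : (3 : K) ≠ 0) (h₁ : IsFlex W x₁ y₁ m₁)
    (h₂ : IsFlex W x₂ y₂ m₂) (hx : x₁ ≠ x₂) :
    ∃ (A : Matrix (Fin 3) (Fin 3) K) (l c c₀ c₁ c₂ ω : K), ω = flexPairing W x₁ y₁ m₁ x₂ y₂ m₂ ∧
      A.det ≠ 0 ∧ c ≠ 0 ∧ l ^ 3 ≠ 1 ∧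
      (∀ p, eval (A.mulVec p) (hesseForm l) = c * eval p (form W)) ∧
      c₀ ≠ 0 ∧ A.mulVec ![0, 1, 0] = c₀ • ![0, 1, -ω ^ 2] ∧
      c₁ ≠ 0 ∧ A.mulVec ![x₁, y₁, 1] = c₁ • ![0, -ω ^ 2, 1] ∧
      c₂ ≠ 0 ∧ A.mulVec ![x₂, y₂, 1] = c₂ • ![1, 0, -ω] ∧
      A.mulVec ![0, 1, 0] 0 = 0 ∧
      ∀ x y m, IsFlex W x y m → A.mulVec ![x, y, 1] 0 * A.mulVec ![x, y, 1] 1 *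
        A.mulVec ![x, y, 1] 2 = 0 := by
  obtain ⟨e₁, e₂, e₃⟩ := h₁.relative h₂ rfl rfl rfl rfl rfl
  have hβ0 := h₁.ne
  have hD0 := h₂.ne
  have hpair : flexPairing W x₁ y₁ m₁ x₂ y₂ m₂ = flexPairing W x₁ y₁ m₁ x₂ y₂ m₂ := rfl
  have hu0 : x₂ - x₁ ≠ 0 := sub_ne_zero.2 hx.symm
  have hrel (x y m : K) (h : IsFlex W x y m) := h₁.relative h rfl rfl rfl rfl rfl
  rw [show 2 * y₂ + W.a₁ * x₂ + W.a₃ = 2 * (y₂ - y₁ - m₁ * (x₂ - x₁)) +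
    (W.a₁ + 2 * m₁) * (x₂ - x₁) + (2 * y₁ + W.a₁ * x₁ + W.a₃) by ring] at hD0
  conv_rhs at hpair => rw [flexPairing,
    show (-y₂ - W.a₁ * x₂ - W.a₃) - y₁ - m₁ * (x₂ - x₁) = -((y₂ - y₁ - m₁ * (x₂ - x₁)) +
      (W.a₁ + 2 * m₁) * (x₂ - x₁) + (2 * y₁ + W.a₁ * x₁ + W.a₃)) by ring,
    show y₁ - y₂ - m₂ * (x₁ - x₂) = (m₂ - m₁) * (x₂ - x₁) - (y₂ - y₁ - m₁ * (x₂ - x₁)) by ring,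
    show y₁ - (-y₂ - W.a₁ * x₂ - W.a₃) - (-m₂ - W.a₁) * (x₁ - x₂) =
      (2 * y₁ + W.a₁ * x₁ + W.a₃) + (y₂ - y₁ - m₁ * (x₂ - x₁)) - (m₂ - m₁) * (x₂ - x₁) by ring]
  have hT (γ ω : K) := hesseMatrix_mulVec (W.a₁ + 2 * m₁) (2 * y₁ + W.a₁ * x₁ + W.a₃) γ ω x₁ y₁ m₁
    ![x₂, y₂, 1]
  have hT₀ : ![x₂, y₂, 1] 0 - x₁ * ![x₂, y₂, 1] 2 = x₂ - x₁ := by simp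
  simp only [hT₀] at hT
  have hF := h₁.eval_form
  set α := W.a₁ + 2 * m₁ with hα
  set β := 2 * y₁ + W.a₁ * x₁ + W.a₃ with hβ
  set u := x₂ - x₁
  set v := y₂ - y₁ - m₁ * u
  set μ := m₂ - m₁
  have hψ : 3 * u ^ 3 + α ^ 2 * u ^ 2 + 3 * α * β * u + 3 * β ^ 2 = 0 :=
    (mul_eq_zero.1 (flexPolynomial_eq_zero e₁ e₂ e₃)).resolve_left hu0
  -- The Hesse form needs a cube root of α³ - 27β; this one sends T to (1 : 0 : -ω).
  obtain ⟨γ, hγ⟩ : ∃ γ, γ * u = α * u + 3 * β := ⟨_, div_mul_cancel₀ _ hu0⟩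
  have hγ0 : γ ≠ 0 := by
    rintro rfl
    apply mul_ne_zero h3 (pow_ne_zero 2 hD0)
    linear_combination 12 * e₁ + 4 * hψ + (α * u + 3 * β) * hγ
  have hγ3 : γ ^ 3 = α ^ 3 - 27 * β := by
    apply mul_right_cancel₀ (pow_ne_zero 3 hu0)
    rw [← mul_pow, hγ]
    linear_combination 9 * β * hψ
  -- By `hψ` this is a primitive cube root of unity, namely the one for which Y vanishes at T.
  obtain ⟨ω, hω⟩ : ∃ ω, ω * (2 * v + α * u + β) = β - v := ⟨_, div_mul_cancel₀ _ hD0⟩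
  have hω3 : ω ^ 2 + ω + 1 = 0 := by
    apply mul_right_cancel₀ (pow_ne_zero 2 hD0)
    linear_combination (ω * (2 * v + α * u + β) + β - v + (2 * v + α * u + β)) * hω + hψ + 3 * e₁
  have hω1 := ne_one_of_primitive h3 hω3
  have hω0 : ω ≠ 0 := by
    rintro rfl
    simp at hω3
  have hv0 : v ≠ 0 := by
    intro h
    rw [h, zero_mul] at e₁
    exact hu0 (pow_eq_zero_iff (by norm_num) |>.1 e₁.symm)
  have hw0 : v + α * u + β ≠ 0 := by
    intro h
    rw [h, mul_zero] at e₁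
    exact hu0 (pow_eq_zero_iff (by norm_num) |>.1 e₁.symm)
  have hY : α * u + (1 - ω) * v + (1 - ω ^ 2) * β = 0 := by
    linear_combination -ω ^ 2 * (v * hω3 - hω) + (ω - 1) * (ω * v - (v + α * u + β)) * hω3
  have hl : μ * u - v = -ω ^ 2 * v := by
    apply mul_right_cancel₀ hD0
    linear_combination u * e₂ - 3 * e₁ + v * (2 * v + α * u + β) * hω3 - v * hω
  have hl' : β + v - μ * u = ω * (v + α * u + β) := by
    linear_combination -hl - hω + v * hω3
  refine ⟨hesseMatrix α β γ ω x₁ y₁ m₁, α / γ, 27 * β, 1 - ω, (1 - ω) * β, (1 - ω) * (β - v), ω,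
    ?_, ?_, ?_, ?_, ?_, hω1, ?_, mul_ne_zero hω1 hβ0, ?_, ?_, ?_, ?_, ?_⟩
  -- With w = v + αu + β the pairing is (-w/v) / (ωw / (-ω²v)) = ω.
  · rw [hpair, hl, hl']
    field_simp
  · rw [hesseMatrix_det _ _ _ _ _ _ hω3]
    exact mul_ne_zero (mul_ne_zero hγ0 hβ0) (pow_ne_zero 3 hω1)
  · refine mul_ne_zero ?_ hβ0
    rw [show (27 : K) = 3 ^ 3 by norm_num]
    exact pow_ne_zero 3 h3
  · rw [div_pow, Ne, div_eq_one_iff_eq (pow_ne_zero 3 hγ0), hγ3]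
    intro h
    refine mul_ne_zero (pow_ne_zero 3 h3) hβ0 ?_
    linear_combination h
  · intro p
    rw [eval_hesseForm, hesseMatrix_mulVec, hF]
    simp only [Matrix.cons_val]
    -- As lX = αu, the identity evaluates Y³ + Z³ - 3lXYZ + α³u³, and X³ = (α³ - 27β)u³ supplies the
    -- missing -27βu³.
    have h := pencil_identity hω3 (α * (p 0 - x₁ * p 2))
      (p 1 - y₁ * p 2 - m₁ * (p 0 - x₁ * p 2)) (β * p 2)
    simp only [← mul_assoc (1 - ω ^ 2) β, ← mul_assoc (1 - ω) β] at h
    generalize α * (p 0 - x₁ * p 2) + (1 - ω) * (p 1 - y₁ * p 2 - m₁ * (p 0 - x₁ * p 2)) +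
        (1 - ω ^ 2) * β * p 2 = Y at h ⊢
    generalize α * (p 0 - x₁ * p 2) + (1 - ω ^ 2) * (p 1 - y₁ * p 2 - m₁ * (p 0 - x₁ * p 2)) +
        (1 - ω) * β * p 2 = Z at h ⊢
    have hαγ : α / γ * γ = α := div_mul_cancel₀ _ hγ0
    linear_combination h + (p 0 - x₁ * p 2) ^ 3 * hγ3 - 3 * (p 0 - x₁ * p 2) * Y * Z * hαγ +
      27 * β * p 2 * (p 1 - y₁ * p 2 - m₁ * (p 0 - x₁ * p 2)) *
        ((p 0 - x₁ * p 2) * hα + p 2 * hβ)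
  · rw [hesseMatrix_mulVec]
    ext i
    fin_cases i <;> simp
    linear_combination (1 - ω) * hω3
  · rw [hesseMatrix_mulVec]
    ext i
    fin_cases i <;> simp
    linear_combination β * (1 - ω) * hω3
  · refine mul_ne_zero hω1 ?_
    rw [← hω]
    exact mul_ne_zero hω0 hD0
  · rw [hT]
    ext i
    fin_cases i
    · simp
      linear_combination hγ + hY + β * hω3
    · simpa using hY
    · simp
      linear_combination hY
  · rw [hesseMatrix_mulVec]
    simp
  · intro x y m h
    rw [hesseMatrix_mulVec]
    obtain ⟨f₁, f₂, f₃⟩ := hrel x y m h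
    have hf := flexPolynomial_eq_zero f₁ f₂ f₃
    simp only [Matrix.cons_val, mul_one]
    -- On the curve YZ = 3u³ + α²u² + 3αβu + 3β², so XYZ is γ times the flex polynomial.
    rw [mul_assoc, conjugate_mul hω3]
    linear_combination γ * hf + 3 * γ * (x - x₁) * f₁

end HesseForm

/-! ### Collinearity and the group law -/

section Collinear

variable {K : Type*} [Field K]

/-- The determinant of three vectors. -/
def tripleDet (p q r : Fin 3 → K) : K :=
  p 0 * (q 1 * r 2 - q 2 * r 1) - p 1 * (q 0 * r 2 - q 2 * r 0) + p 2 * (q 0 * r 1 - q 1 * r 0)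

theorem tripleDet_mulVec (A : Matrix (Fin 3) (Fin 3) K) (p q r : Fin 3 → K) :
    tripleDet (A.mulVec p) (A.mulVec q) (A.mulVec r) = A.det * tripleDet p q r := by
  simp only [tripleDet, Matrix.mulVec, dotProduct, Fin.sum_univ_three, Matrix.det_fin_three]
  ring

theorem tripleDet_smul (a b c : K) (p q r : Fin 3 → K) :
    tripleDet (a • p) (b • q) (c • r) = a * b * c * tripleDet p q r := by
  simp only [tripleDet, Pi.smul_apply, smul_eq_mul]
  ring

variable {W : WeierstrassCurve K}

theorem coords_injective_smul {P Q : W.toAffine.Point} {c : K}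
    (h : coords P = c • coords Q) : P = Q := by
  cases P with
  | zero =>
    cases Q with
    | zero => rfl
    | some x y hxy =>
      have h1 := congrFun h 1
      have h2 := congrFun h 2
      simp [coords] at h1 h2
      simp [← h2] at h1
  | some x y hxy =>
    cases Q with
    | zero => simpa [coords] using congrFun h 2
    | some x' y' hxy' =>
      have h0 := congrFun h 0
      have h1 := congrFun h 1
      have h2 := congrFun h 2
      simp [coords] at h0 h1 h2
      subst h2
      simp only [one_mul] at h0 h1
      subst h0 h1
      rfl

theorem exists_eq_smul_coords [W.IsElliptic] {p : Fin 3 → K} (hp : p ≠ 0)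
    (h : eval p (form W) = 0) : ∃ (R : W.toAffine.Point) (c : K), c ≠ 0 ∧ p = c • coords R := by
  by_cases h2 : p 2 = 0
  · have h0 : p 0 = 0 := by
      rw [form, WeierstrassCurve.Projective.eval_polynomial, h2] at h
      simpa using h
    refine ⟨.zero, p 1, fun h1 => hp ?_, ?_⟩ <;> ext i <;> fin_cases i <;> simp [coords, *]
  · have heq : W.toAffine.Equation (p 0 / p 2) (p 1 / p 2) :=
      (WeierstrassCurve.Projective.equation_of_Z_ne_zero h2).1 h
    refine ⟨.some _ _ (W.toAffine.equation_iff_nonsingular.1 heq), p 2, h2, ?_⟩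
    ext i
    fin_cases i <;> simp [coords] <;> field_simp

theorem isSmooth_form [W.IsElliptic] : IsSmooth (form W) := by
  intro p hp h
  obtain ⟨R, c, hc, rfl⟩ := exists_eq_smul_coords hp h
  have hns : WeierstrassCurve.Projective.Nonsingular W.toProjective (coords R) := by
    cases R with
    | zero => exact WeierstrassCurve.Projective.nonsingular_zero
    | some x y hxy => exact (WeierstrassCurve.Projective.nonsingular_some x y).2 hxy
  have := ((WeierstrassCurve.Projective.nonsingular_smul (coords R) hc.isUnit).2 hns).2
  rcases this with h | h | h
  exacts [⟨0, h⟩, ⟨1, h⟩, ⟨2, h⟩]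

variable [DecidableEq K]

theorem tripleDet_coords_eq_zero {P Q : W.toAffine.Point} (h : P ≠ Q) :
    tripleDet (coords P) (coords Q) (coords (-(P + Q))) = 0 := by
  cases P with
  | zero =>
    cases Q with
    | zero => exact absurd rfl h
    | some x y hxy =>
      rw [← WeierstrassCurve.Affine.Point.zero_def, zero_add,
        WeierstrassCurve.Affine.Point.neg_some]
      simp [tripleDet, coords]
  | some x₁ y₁ h₁ =>
    cases Q with
    | zero =>
      rw [← WeierstrassCurve.Affine.Point.zero_def, add_zero,
        WeierstrassCurve.Affine.Point.neg_some]
      simp [tripleDet, coords]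
    | some x₂ y₂ h₂ =>
      by_cases hx : x₁ = x₂
      · have hPQ : (WeierstrassCurve.Affine.Point.some x₁ y₁ h₁ : W.toAffine.Point) =
            -.some x₂ y₂ h₂ :=
          ((WeierstrassCurve.Affine.Point.X_eq_iff (h₁ := h₁) (h₂ := h₂)).1 hx).resolve_left h
        rw [hPQ, neg_add_cancel, neg_zero, WeierstrassCurve.Affine.Point.neg_some]
        simp [tripleDet, coords]
      · rw [WeierstrassCurve.Affine.Point.add_of_X_ne hx, WeierstrassCurve.Affine.Point.neg_some]
        simp only [WeierstrassCurve.Affine.addY, WeierstrassCurve.Affine.negY_negY]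
        have hx' := sub_ne_zero.2 hx
        simp only [tripleDet, coords, WeierstrassCurve.Affine.negAddY, Matrix.cons_val,
          W.toAffine.slope_of_X_ne hx]
        field_simp
        ring

theorem add_eq_neg_of_tripleDet_some {x₁ y₁ x₂ y₂ : K} {h₁ : W.toAffine.Nonsingular x₁ y₁}
    {h₂ : W.toAffine.Nonsingular x₂ y₂} {R : W.toAffine.Point}
    (hP : (.some x₁ y₁ h₁ : W.toAffine.Point) ≠ .some x₂ y₂ h₂)
    (hRP : R ≠ .some x₁ y₁ h₁) (hRQ : R ≠ .some x₂ y₂ h₂)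
    (h : tripleDet ![x₁, y₁, 1] ![x₂, y₂, 1] (coords R) = 0) :
    R = -(.some x₁ y₁ h₁ + .some x₂ y₂ h₂) := by
  by_cases hx : x₁ = x₂
  · have hPQ : (WeierstrassCurve.Affine.Point.some x₁ y₁ h₁ : W.toAffine.Point) =
        -.some x₂ y₂ h₂ :=
      ((WeierstrassCurve.Affine.Point.X_eq_iff (h₁ := h₁) (h₂ := h₂)).1 hx).resolve_left hP
    rw [hPQ, neg_add_cancel, neg_zero]
    cases R with
    | zero => rfl
    | some x₃ y₃ h₃ =>
      exfalso
      subst hx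
      have hy : y₁ - y₂ ≠ 0 := by
        intro hy
        obtain rfl := sub_eq_zero.1 hy
        exact hP rfl
      have hx : x₃ = x₁ := by
        apply mul_right_cancel₀ hy
        simp [tripleDet, coords] at h
        linear_combination h
      rcases (WeierstrassCurve.Affine.Point.X_eq_iff (h₁ := h₃) (h₂ := h₂)).1 hx with h | h
      · exact hRQ h
      · exact hRP (h.trans hPQ.symm)
  · cases R with
    | zero =>
      simp [tripleDet, coords] at h
      exact absurd (by linear_combination -h) hx
    | some x₃ y₃ h₃ =>
      have hx' := sub_ne_zero.2 hx
      have hsl : W.toAffine.slope x₁ x₂ y₁ y₂ * (x₁ - x₂) = y₁ - y₂ := by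
        rw [W.toAffine.slope_of_X_ne hx, div_mul_cancel₀ _ hx']
      have hpoly := WeierstrassCurve.Affine.addPolynomial_slope h₁.1 h₂.1 fun h => hx h.1
      rw [WeierstrassCurve.Affine.Point.add_of_X_ne hx, WeierstrassCurve.Affine.Point.neg_some,
        WeierstrassCurve.Affine.Point.some.injEq, WeierstrassCurve.Affine.addY]
      simp only [WeierstrassCurve.Affine.negY_negY, WeierstrassCurve.Affine.negAddY]
      set ℓ := W.toAffine.slope x₁ x₂ y₁ y₂
      have hy₃ : y₃ = ℓ * (x₃ - x₁) + y₁ := by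
        apply mul_right_cancel₀ hx'
        simp [tripleDet, coords] at h
        linear_combination -h - (x₃ - x₁) * hsl
      have hne {x y : K} {hxy : W.toAffine.Nonsingular x y}
          (hR : (.some x₃ y₃ h₃ : W.toAffine.Point) ≠ .some x y hxy)
          (hy : y = ℓ * (x - x₁) + y₁) : x₃ - x ≠ 0 := by
        intro h0
        obtain rfl := sub_eq_zero.1 h0
        obtain rfl := hy₃.trans hy.symm
        exact hR rfl
      have hx1 := hne hRP (by ring)
      have hx2 := hne hRQ (by linear_combination hsl)
      have hx3 : x₃ = W.toAffine.addX x₁ x₂ ℓ := by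
        have := congrArg (Polynomial.eval x₃) hpoly
        rw [WeierstrassCurve.Affine.addPolynomial_eq] at this
        simp [Cubic.toPoly] at this
        have he := (W.toAffine.equation_iff x₃ y₃).1 h₃.1
        rw [hy₃] at he
        -- The chord meets the cubic at the abscissas x₁, x₂ and `addX`; R ≠ P, Q leaves only the
        -- last.
        have h0 : (x₃ - x₁) * (x₃ - x₂) * (x₃ - W.toAffine.addX x₁ x₂ ℓ) = 0 := by
          rw [WeierstrassCurve.Affine.addX]
          linear_combination this - he
        exact sub_eq_zero.1 ((mul_eq_zero.1 h0).resolve_left (mul_ne_zero hx1 hx2))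
      exact ⟨hx3, by rw [hy₃, hx3]⟩

/-- Three distinct collinear points of a Weierstrass curve have sum zero. -/
theorem add_add_eq_zero_of_tripleDet {P Q R : W.toAffine.Point} (hPQ : P ≠ Q) (hRP : R ≠ P)
    (hRQ : R ≠ Q) (h : tripleDet (coords P) (coords Q) (coords R) = 0) : P + Q + R = 0 := by
  match P, Q, R, hPQ, hRP, hRQ, h with
  | .some _ _ _, .some _ _ _, R, hPQ, hRP, hRQ, h =>
    rw [add_eq_neg_of_tripleDet_some hPQ hRP hRQ h, add_neg_cancel]
  | .zero, .zero, _, hPQ, _, _, _ => exact absurd rfl hPQ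
  | .zero, _, .zero, _, hRP, _, _ => exact absurd rfl hRP
  | _, .zero, .zero, _, _, hRQ, _ => exact absurd rfl hRQ
  | .zero, .some _ _ _, .some _ _ _, hPQ, hRP, hRQ, h =>
    have := add_eq_neg_of_tripleDet_some hRQ hRP.symm hPQ
      (by simp only [tripleDet, coords] at h ⊢; linear_combination -h)
    rw [this]
    abel
  | .some _ _ _, .zero, .some _ _ _, hPQ, hRP, hRQ, h =>
    have := add_eq_neg_of_tripleDet_some hRP hRQ.symm hPQ.symm
      (by simp only [tripleDet, coords] at h ⊢; linear_combination h)
    rw [this]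
    abel

end Collinear

/-! ### Existence and generation of the 3-torsion -/

section ThreeTorsion

variable {K : Type*} [Field K] {W : WeierstrassCurve K}

theorem eq_or_eq_neg_of_coords {P Q : W.toAffine.Point} (hP : P ≠ 0) (hQ : Q ≠ 0)
    (h : coords P 0 = coords Q 0) : P = Q ∨ P = -Q := by
  cases P with
  | zero => exact absurd rfl hP
  | some x y hxy =>
    cases Q with
    | zero => exact absurd rfl hQ
    | some x' y' hxy' => exact WeierstrassCurve.Affine.Point.X_eq_iff.1 h

theorem exists_nonsingular [IsAlgClosed K] [W.IsElliptic] (h2 : (2 : K) ≠ 0) (x : K) :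
    ∃ y, W.toAffine.Nonsingular x y := by
  obtain ⟨s, hs⟩ := IsAlgClosed.exists_pow_nat_eq ((W.a₁ * x + W.a₃) ^ 2 +
    4 * (x ^ 3 + W.a₂ * x ^ 2 + W.a₄ * x + W.a₆)) (n := 2) (by norm_num)
  refine ⟨(-(W.a₁ * x + W.a₃) + s) / 2, W.toAffine.equation_iff_nonsingular.1 ?_⟩
  rw [W.toAffine.equation_iff]
  field_simp
  linear_combination hs

theorem exists_isFlex_pair [IsAlgClosed K] [W.IsElliptic] (h2 : (2 : K) ≠ 0) (h3 : (3 : K) ≠ 0) :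
    ∃ x₁ y₁ m₁ x₂ y₂ m₂, IsFlex W x₁ y₁ m₁ ∧ IsFlex W x₂ y₂ m₂ ∧ x₁ ≠ x₂ := by
  obtain ⟨x₁, hx₁⟩ := IsAlgClosed.exists_root W.Ψ₃ fun h => by
    have := Polynomial.natDegree_eq_of_degree_eq_some h
    rw [W.natDegree_Ψ₃ h3] at this
    norm_num at this
  obtain ⟨y₁, h₁⟩ := exists_nonsingular (W := W) h2 x₁
  obtain ⟨m₁, hm₁⟩ := exists_isFlex hx₁ h₁
  have e1 := hm₁.equation
  have e2 := hm₁.slope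
  have e3 := hm₁.flex
  have hβ := hm₁.ne
  set α := W.a₁ + 2 * m₁ with hα
  set β := 2 * y₁ + W.a₁ * x₁ + W.a₃ with hβ'
  -- The cubic is Ψ₃(x₁ + u)/u; its constant term 3β² ≠ 0 forces u ≠ 0, hence a second abscissa.
  obtain ⟨u, hu⟩ := IsAlgClosed.exists_root
    (Cubic.toPoly ⟨3, α ^ 2, 3 * α * β, 3 * β ^ 2⟩ : Polynomial K) (by
      rw [Cubic.degree_of_a_ne_zero h3]; norm_num)
  simp [Cubic.toPoly] at hu
  have hu0 : u ≠ 0 := by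
    rintro rfl
    simp [h3, hβ] at hu
  obtain ⟨y₂, h₂⟩ := exists_nonsingular (W := W) h2 (x₁ + u)
  obtain ⟨m₂, hm₂⟩ := exists_isFlex (x := x₁ + u) (by
    have hΨ := hx₁.eq_zero
    simp only [WeierstrassCurve.Ψ₃, WeierstrassCurve.b₂, WeierstrassCurve.b₄,
      WeierstrassCurve.b₆, WeierstrassCurve.b₈, Polynomial.eval_add, Polynomial.eval_mul,
      Polynomial.eval_pow, Polynomial.eval_C, Polynomial.eval_X, Polynomial.eval_ofNat] at hΨ ⊢
    have f1 : α ^ 2 = W.a₁ ^ 2 + 4 * W.a₂ + 12 * x₁ := by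
      linear_combination 4 * e3
    have f2 : α * β = 6 * x₁ ^ 2 + (W.a₁ ^ 2 + 4 * W.a₂) * x₁ +
        (2 * W.a₄ + W.a₁ * W.a₃) := by
      linear_combination 2 * e2
    have f3 : β ^ 2 = 4 * x₁ ^ 3 + (W.a₁ ^ 2 + 4 * W.a₂) * x₁ ^ 2 +
        2 * (2 * W.a₄ + W.a₁ * W.a₃) * x₁ + (W.a₃ ^ 2 + 4 * W.a₆) := by
      linear_combination 4 * e1
    linear_combination hΨ + u * hu - u ^ 3 * f1 - 3 * u ^ 2 * f2 - 3 * u * f3) h₂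
  exact ⟨x₁, y₁, m₁, x₁ + u, y₂, m₂, hm₁, hm₂, by simpa using hu0⟩

variable [DecidableEq K]

theorem eval_Ψ₃_coords {P : W.toAffine.Point} (hP : P ∈ threeTorsion W) (h0 : P ≠ 0) :
    W.Ψ₃.eval (coords P 0) = 0 := by
  cases P with
  | zero => exact absurd rfl h0
  | some x y hxy =>
    obtain ⟨m, hm⟩ := some_mem_threeTorsion_iff.1 hP
    exact hm.eval_Ψ₃

theorem threeTorsion_add_add (P : threeTorsion W) : P + P + P = 0 := by
  have h := three_smul_eq_zero_iff.1 P.2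
  ext1
  simp [h]

/-- Two independent points generate the `3`-torsion. -/
theorem eq_or_of_mem_threeTorsion (h3 : (3 : K) ≠ 0) {S T : threeTorsion W} (hS : S ≠ 0)
    (hT : T ≠ 0) (hST : S ≠ T) (hST' : S ≠ -T) {P : threeTorsion W} (hP : P ≠ 0) :
    (P = S ∨ P = -S) ∨ (P = T ∨ P = -T) ∨ (P = S + T ∨ P = -(S + T)) ∨
      (P = S - T ∨ P = -(S - T)) := by
  by_contra! h
  have h3S := threeTorsion_add_add S
  have h3T := threeTorsion_add_add T
  let f : threeTorsion W → K := fun P => coords P.1 0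
  have hf {A B : threeTorsion W} (hA : A ≠ 0) (hB : B ≠ 0) (h1 : A ≠ B) (h2 : A ≠ -B) :
      f A ≠ f B := by
    intro h
    rcases eq_or_eq_neg_of_coords (by simpa using hA) (by simpa using hB) h with h | h
    · exact h1 (Subtype.ext h)
    · exact h2 (Subtype.ext h)
  have hadd : S + T ≠ 0 := fun h => hST' (eq_neg_of_add_eq_zero_left h)
  have hsub : S - T ≠ 0 := sub_ne_zero.2 hST
  -- Abscissas separate points up to sign, so a further pair ±P would give Ψ₃, of degree at most 4,
  -- a fifth root.
  have hcard : ({f P, f S, f T, f (S + T), f (S - T)} : Finset K).card = 5 := by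
    rw [Finset.card_insert_of_notMem, Finset.card_insert_of_notMem, Finset.card_insert_of_notMem,
      Finset.card_pair]
    · refine hf hadd hsub (fun h => hT ?_) (fun h => hS ?_)
      · linear_combination (norm := module) h3T - h
      · linear_combination (norm := module) h3S - h
    · simp only [Finset.mem_insert, Finset.mem_singleton, not_or]
      refine ⟨hf hT hadd (fun h => hS ?_) (fun h => hST ?_),
        hf hT hsub (fun h => hST' ?_) (fun h => hS ?_)⟩
      · linear_combination (norm := module) -h
      · linear_combination (norm := module) h - h3T
      · linear_combination (norm := module) h3T - h
      · linear_combination (norm := module) h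
    · simp only [Finset.mem_insert, Finset.mem_singleton, not_or]
      refine ⟨hf hS hT hST hST', hf hS hadd (fun h => hT ?_) (fun h => hST ?_),
        hf hS hsub (fun h => hT ?_) (fun h => hST' ?_)⟩
      · linear_combination (norm := module) -h
      · linear_combination (norm := module) h3S - h
      · linear_combination (norm := module) h
      · linear_combination (norm := module) h3S - h
    · simp only [Finset.mem_insert, Finset.mem_singleton, not_or]
      exact ⟨hf hP hS h.1.1 h.1.2, hf hP hT h.2.1.1 h.2.1.2, hf hP hadd h.2.2.1.1 h.2.2.1.2,
        hf hP hsub h.2.2.2.1 h.2.2.2.2⟩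
  have hΨ : W.Ψ₃ ≠ 0 := by
    intro h0
    apply W.coeff_Ψ₃_ne_zero h3
    simp [h0]
  have hle := Polynomial.card_le_degree_of_subset_roots (p := W.Ψ₃)
    (Z := {f P, f S, f T, f (S + T), f (S - T)}) (by
      have hr {A : threeTorsion W} (hA : A ≠ 0) : f A ∈ W.Ψ₃.roots :=
        (Polynomial.mem_roots hΨ).2 (eval_Ψ₃_coords A.2 (by simpa using hA))
      intro z hz
      simp only [Finset.mem_val, Finset.mem_insert, Finset.mem_singleton] at hz
      rcases hz with rfl | rfl | rfl | rfl | rfl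
      exacts [hr hP, hr hS, hr hT, hr hadd, hr hsub])
  have := W.natDegree_Ψ₃_le
  omega

/-- The operation -(P + Q) is the third point on a line. Taking Q = 0 gives negatives, and then ±S,
±T produce ±(S + T) and ±(S - T). -/
theorem threeTorsion_induction (h3 : (3 : K) ≠ 0) {S T : threeTorsion W} (hS : S ≠ 0)
    (hT : T ≠ 0) (hST : S ≠ T) (hST' : S ≠ -T) {G : threeTorsion W → Prop} (h0 : G 0) (hGS : G S)
    (hGT : G T) (h : ∀ P Q, P ≠ Q → G P → G Q → G (-(P + Q))) (P : threeTorsion W) : G P := by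
  have hneg {A : threeTorsion W} (hA : A ≠ 0) (hG : G A) : G (-A) := by
    simpa using h A 0 hA hG h0
  have hadd : S + T ≠ 0 := fun h => hST' (eq_neg_of_add_eq_zero_left h)
  have hsub : S - T ≠ 0 := sub_ne_zero.2 hST
  have hGadd : G (-(S + T)) := h S T hST hGS hGT
  have hGsub : G (-(S - T)) := by
    simpa [sub_eq_add_neg] using h S (-T) hST' hGS (hneg hT hGT)
  by_cases hP : P = 0
  · rwa [hP]
  rcases eq_or_of_mem_threeTorsion h3 hS hT hST hST' hP with
    (rfl | rfl) | (rfl | rfl) | (rfl | rfl) | (rfl | rfl)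
  exacts [hGS, hneg hS hGS, hGT, hneg hT hGT, by simpa using hneg (neg_ne_zero.2 hadd) hGadd,
    hGadd, by simpa using hneg (neg_ne_zero.2 hsub) hGsub, hGsub]

end ThreeTorsion

/-! ### Linear substitutions and the Hesse pencil -/

section Subst

variable {K : Type*} [Field K]

theorem eval_subst (A : Matrix (Fin 3) (Fin 3) K) (G : MvPolynomial (Fin 3) K) (p : Fin 3 → K) :
    eval p (subst A G) = eval (A.mulVec p) G := by
  rw [subst, ← coe_aeval_eq_eval, RingHom.coe_coe, aeval_bind₁, ← coe_aeval_eq_eval,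
    RingHom.coe_coe]
  congr 2
  ext i
  simp [Matrix.mulVec, dotProduct]

theorem pderiv_subst (A : Matrix (Fin 3) (Fin 3) K) (G : MvPolynomial (Fin 3) K) (i : Fin 3) :
    pderiv i (subst A G) = ∑ j, C (A j i) * subst A (pderiv j G) := by
  simp only [subst]
  induction G using MvPolynomial.induction_on with
  | C a => simp
  | add f g hf hg => simp only [map_add, hf, hg, mul_add, Finset.sum_add_distrib]
  | mul_X f k hf =>
    simp only [map_mul, Derivation.leibniz, smul_eq_mul, bind₁_X_right, hf, map_add, mul_add,
      Finset.sum_add_distrib, map_sum, pderiv_X, pderiv_C, mul_zero, add_zero]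
    congr 1
    · simp [Pi.single_apply, Finset.sum_ite_eq, mul_comm]
    · rw [Finset.mul_sum]
      exact Finset.sum_congr rfl fun j _ => by ring

theorem hessian_C_mul (c : K) (F : MvPolynomial (Fin 3) K) :
    hessian (C c * F) = C (c ^ 3) * hessian F := by
  simp only [hessian, Matrix.det_fin_three, Matrix.of_apply, pderiv_C_mul, C_pow]
  ring

/-- The Hessian is a covariant. -/
theorem hessian_subst (A : Matrix (Fin 3) (Fin 3) K) (F : MvPolynomial (Fin 3) K) :
    hessian (subst A F) = C (A.det ^ 2) * subst A (hessian F) := by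
  have hM : (Matrix.of fun i j : Fin 3 => pderiv i (pderiv j (subst A F))) =
      (A.map C).transpose *
        ((Matrix.of fun i j : Fin 3 => pderiv i (pderiv j F)).map
          (bind₁ fun i => ∑ j, C (A i j) * X j)) * A.map C := by
    ext1 i j
    simp only [Matrix.of_apply, pderiv_subst, map_sum, pderiv_C_mul, Matrix.mul_apply,
      Matrix.transpose_apply, Matrix.map_apply, Finset.sum_mul]
    refine Finset.sum_congr rfl fun a _ => ?_
    rw [Finset.mul_sum]
    refine Finset.sum_congr rfl fun b _ => ?_
    rw [subst]
    ring
  rw [hessian, hM, Matrix.det_mul, Matrix.det_mul, Matrix.det_transpose, ← RingHom.mapMatrix_apply,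
    ← RingHom.map_det, ← AlgHom.mapMatrix_apply, ← AlgHom.map_det, C_pow, subst, hessian]
  ring

/-- By the chain rule c∇F(v) = Aᵗ∇G(Av), and Aᵗ is invertible. -/
theorem IsSmooth.of_subst {F G : MvPolynomial (Fin 3) K} {A : Matrix (Fin 3) (Fin 3) K} {c : K}
    (hG : IsSmooth G) (hA : A.det ≠ 0) (h : subst A G = C c * F) : IsSmooth F := by
  intro v hv hF
  by_contra! hd
  have hAv : A.mulVec v ≠ 0 := fun h0 => hv (Matrix.eq_zero_of_mulVec_eq_zero hA h0)
  obtain ⟨j, hj⟩ := hG (A.mulVec v) hAv (by rw [← eval_subst, h, map_mul, hF, mul_zero])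
  refine hj (congrFun (Matrix.eq_zero_of_vecMul_eq_zero hA
    (v := fun j => eval (A.mulVec v) (pderiv j G)) ?_) j)
  ext i
  have := congrArg (eval v) (congrArg (pderiv i) h)
  rw [pderiv_subst, pderiv_C_mul, map_sum, map_mul, hd, mul_zero] at this
  simpa [eval_subst, Matrix.vecMul, dotProduct, mul_comm] using this

/-- A curve that is a Hesse cubic in some coordinates has the Hesse cubics as Hesse pencil. -/
theorem exists_hesseFibre [Infinite K] (h2 : (2 : K) ≠ 0) (h3 : (3 : K) ≠ 0)
    {F : MvPolynomial (Fin 3) K} {A : Matrix (Fin 3) (Fin 3) K} {c l : K} (hA : A.det ≠ 0)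
    (hc : c ≠ 0) (hl : l ^ 3 ≠ 1) (h : subst A (hesseForm l) = C c * F) (l' : K) :
    ∃ (t : ℙ K (Fin 2 → K)) (a : K), a ≠ 0 ∧ hesseFibre F t = C a * subst A (hesseForm l') := by
  have hH : subst A (hessian (hesseForm l)) = C (c ^ 3 / A.det ^ 2) * hessian F := by
    have h' := congrArg hessian h
    rw [hessian_subst, hessian_C_mul] at h'
    rw [div_eq_inv_mul, C_mul, mul_assoc, ← h', ← mul_assoc, ← C_mul,
      inv_mul_cancel₀ (pow_ne_zero 2 hA), C_1, one_mul]
  have hD : 216 * (1 - l ^ 3) ≠ 0 := by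
    refine mul_ne_zero ?_ (sub_ne_zero.2 hl.symm)
    rw [show (216 : K) = 2 ^ 3 * 3 ^ 3 by norm_num]
    exact mul_ne_zero (pow_ne_zero 3 h2) (pow_ne_zero 3 h3)
  -- The weight 1 + 54l²s keeps the coefficient of the cubes at 1; comparing coefficients of XYZ
  -- then determines s.
  obtain ⟨s, hs⟩ : ∃ s, s * (216 * (1 - l ^ 3)) = 3 * (l - l') := ⟨_, div_mul_cancel₀ _ hD⟩
  have hcomb : hesseForm l' =
      C (1 + 54 * l ^ 2 * s) * hesseForm l + C s * hessian (hesseForm l) := by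
    rw [hessian_hesseForm, hesseForm, hesseForm]
    have hs' : 3 * l' = (1 + 54 * l ^ 2 * s) * (3 * l) - s * (216 - 54 * l ^ 3) := by
      linear_combination hs
    rw [hs']
    simp only [C_add, C_sub, C_mul, C_neg, C_1]
    ring
  have hsub : subst A (hesseForm l') = C ((1 + 54 * l ^ 2 * s) * c) * F +
      C (s * (c ^ 3 / A.det ^ 2)) * hessian F := by
    have hmap (a b : K) (f g : MvPolynomial (Fin 3) K) :
        subst A (C a * f + C b * g) = C a * subst A f + C b * subst A g := by
      simp only [subst, map_add, map_mul, bind₁_C_right]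
    rw [hcomb, hmap, h, hH]
    simp only [C_mul]
    ring
  have hne : ![(1 + 54 * l ^ 2 * s) * c, s * (c ^ 3 / A.det ^ 2)] ≠ 0 := by
    intro h0
    have h1 := congrFun h0 0
    have h2 := congrFun h0 1
    simp [hc, hA] at h1 h2
    simp [h2] at h1
  obtain ⟨a, ha⟩ := Projectivization.exists_smul_eq_mk_rep K _ hne
  refine ⟨Projectivization.mk K _ hne, a, a.ne_zero, ?_⟩
  rw [hesseFibre, ← ha, hsub]
  simp [Units.smul_def]
  ring

theorem mulVec_inv_mul_eq {A A' : Matrix (Fin 3) (Fin 3) K} (hA' : A'.det ≠ 0) {p q r : Fin 3 → K}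
    {c c' : K} (hc : c ≠ 0) (hc' : c' ≠ 0) (h : A.mulVec p = c • r) (h' : A'.mulVec q = c' • r) :
    ∃ a : K, a ≠ 0 ∧ (A'⁻¹ * A).mulVec p = a • q := by
  refine ⟨c / c', div_ne_zero hc hc', ?_⟩
  have hr : r = c'⁻¹ • A'.mulVec q := by rw [h', inv_smul_smul₀ hc']
  rw [← Matrix.mulVec_mulVec, h, hr, smul_smul, Matrix.mulVec_smul, Matrix.mulVec_mulVec,
    Matrix.nonsing_inv_mul _ hA'.isUnit, Matrix.one_mulVec, div_eq_mul_inv]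

end Subst

/-! ### Construction of the projectivity -/

section Main

variable {K : Type*} [Field K] {W W' : WeierstrassCurve K}

theorem exists_some_of_ne_zero {P : W.toAffine.Point} (hP : P ≠ 0) :
    ∃ x y hxy, P = .some x y hxy := by
  cases P with
  | zero => exact absurd rfl hP
  | some x y hxy => exact ⟨x, y, hxy, rfl⟩

variable [DecidableEq K]

/-- The set of points at which a projectivity extends `φ` is closed under taking the third point
on a line. -/
theorem exists_mulVec_eq_neg_add [W'.IsElliptic] {B : Matrix (Fin 3) (Fin 3) K}
    (hB : B.det ≠ 0) (φ : threeTorsion W ≃+ threeTorsion W')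
    (hcurve : ∀ P : threeTorsion W, eval (B.mulVec (coords P.1)) (form W') = 0)
    {P Q : threeTorsion W} (hPQ : P ≠ Q)
    (hP : ∃ c : K, c ≠ 0 ∧ B.mulVec (coords P.1) = c • coords (φ P).1)
    (hQ : ∃ c : K, c ≠ 0 ∧ B.mulVec (coords Q.1) = c • coords (φ Q).1) :
    ∃ c : K, c ≠ 0 ∧ B.mulVec (coords (-(P + Q)).1) = c • coords (φ (-(P + Q))).1 := by
  obtain ⟨a, ha, hP⟩ := hP
  obtain ⟨b, hb, hQ⟩ := hQ
  have hBne {v : Fin 3 → K} (hv : v ≠ 0) : B.mulVec v ≠ 0 :=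
    fun h0 => hv (Matrix.eq_zero_of_mulVec_eq_zero hB h0)
  obtain ⟨R, c, hc, hR⟩ := exists_eq_smul_coords (hBne (coords_ne_zero (-(P + Q)).1))
    (hcurve (-(P + Q)))
  have hdet : tripleDet (coords (φ P).1) (coords (φ Q).1) (coords R) = 0 := by
    have h0 := tripleDet_mulVec B (coords P.1) (coords Q.1) (coords (-(P + Q)).1)
    rw [hP, hQ, hR, tripleDet_smul] at h0
    have h1 : tripleDet (coords P.1) (coords Q.1) (coords (-(P + Q)).1) = 0 :=
      tripleDet_coords_eq_zero fun h => hPQ (Subtype.ext h)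
    rw [h1, mul_zero] at h0
    exact (mul_eq_zero.1 h0).resolve_left (mul_ne_zero (mul_ne_zero ha hb) hc)
  -- Injectivity of B on the plane keeps R apart from φ(P) and φ(Q), since -(P + Q) = P or Q would
  -- force P = Q.
  have hne {A : threeTorsion W} {a : K} (ha : a ≠ 0)
      (hA : B.mulVec (coords A.1) = a • coords (φ A).1) (h : R = (φ A).1) : -(P + Q) = A := by
    refine Subtype.ext (coords_injective_smul (c := c / a) ?_)
    rw [← sub_eq_zero]
    by_contra hne
    refine hBne hne ?_
    rw [Matrix.mulVec_sub, Matrix.mulVec_smul, hR, hA, h, smul_smul, div_mul_cancel₀ _ ha,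
      sub_self]
  have h3P := threeTorsion_add_add P
  have h3Q := threeTorsion_add_add Q
  have hsum := add_add_eq_zero_of_tripleDet (fun h => hPQ (φ.injective (Subtype.ext h)))
    (fun h => hPQ (by linear_combination (norm := module) hne ha hP h + h3P))
    (fun h => hPQ (by linear_combination (norm := module) -hne hb hQ h - h3Q)) hdet
  refine ⟨c, hc, ?_⟩
  rw [hR, eq_neg_of_add_eq_zero_right hsum, map_neg, map_add]
  rfl

theorem exists_isFlex_of_ne_zero {P : threeTorsion W} (hP : P ≠ 0) :
    ∃ x y m hxy, P.1 = .some x y hxy ∧ IsFlex W x y m := by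
  obtain ⟨x, y, hxy, h⟩ := exists_some_of_ne_zero (P := P.1) (by simpa using hP)
  obtain ⟨m, hm⟩ := some_mem_threeTorsion_iff.1 (h ▸ P.2)
  exact ⟨x, y, m, hxy, h, hm⟩

theorem exists_hesseFibre_mapsCurve [IsAlgClosed K] [W.IsElliptic] [W'.IsElliptic]
    (h2 : (2 : K) ≠ 0) (h3 : (3 : K) ≠ 0) (φ : threeTorsion W ≃+ threeTorsion W')
    (hφ : RespectsWeilPairings φ) :
    ∃ (t₀ : ℙ K (Fin 2 → K)) (Φ : GL (Fin 3) K), IsSmooth (hesseFibre (form W) t₀) ∧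
      MapsCurve Φ (hesseFibre (form W) t₀) (form W') ∧
      ∀ P : threeTorsion W, Φ • toPlane P.1 = toPlane (φ P).1 := by
  have : Infinite K := IsAlgClosed.instInfinite
  obtain ⟨x₁, y₁, m₁, x₂, y₂, m₂, hf₁, hf₂, hx⟩ := exists_isFlex_pair (W := W) h2 h3
  have hS := W.toAffine.equation_iff_nonsingular.1 ((W.toAffine.equation_iff _ _).2 hf₁.equation)
  have hT := W.toAffine.equation_iff_nonsingular.1 ((W.toAffine.equation_iff _ _).2 hf₂.equation)
  let S : threeTorsion W := ⟨.some x₁ y₁ hS, some_mem_threeTorsion_iff.2 ⟨m₁, hf₁⟩⟩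
  let T : threeTorsion W := ⟨.some x₂ y₂ hT, some_mem_threeTorsion_iff.2 ⟨m₂, hf₂⟩⟩
  have hS0 : S ≠ 0 := fun h => WeierstrassCurve.Affine.Point.some_ne_zero hS (congrArg Subtype.val h)
  have hT0 : T ≠ 0 := fun h => WeierstrassCurve.Affine.Point.some_ne_zero hT (congrArg Subtype.val h)
  have hST : S ≠ T := fun h => hx
    (WeierstrassCurve.Affine.Point.X_eq_iff.2 (Or.inl (congrArg Subtype.val h)))
  have hST' : S ≠ -T := fun h => hx
    (WeierstrassCurve.Affine.Point.X_eq_iff.2 (Or.inr (congrArg Subtype.val h)))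
  obtain ⟨x₁', y₁', m₁', hS', hφS, hf₁'⟩ := exists_isFlex_of_ne_zero (P := φ S)
    ((map_ne_zero_iff φ φ.injective).2 hS0)
  obtain ⟨x₂', y₂', m₂', hT', hφT, hf₂'⟩ := exists_isFlex_of_ne_zero (P := φ T)
    ((map_ne_zero_iff φ φ.injective).2 hT0)
  have hx' : x₁' ≠ x₂' := by
    intro h
    rcases (WeierstrassCurve.Affine.Point.X_eq_iff (h₁ := hS') (h₂ := hT')).1 h with h | h
    · exact hST (φ.injective (Subtype.ext (by rw [hφS, hφT, h])))
    · refine hST' (φ.injective (Subtype.ext ?_))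
      rw [map_neg, hφS, h, ← hφT]
      rfl
  have hpair : flexPairing W x₁ y₁ m₁ x₂ y₂ m₂ = flexPairing W' x₁' y₁' m₁' x₂' y₂' m₂' := by
    refine hφ S T _ _ (hf₁.isWeilPairingValue hf₂ hS hT hx) ?_
    rw [hφS, hφT]
    exact hf₁'.isWeilPairingValue hf₂' hS' hT' hx'
  obtain ⟨A, l, c, c₀, c₁, c₂, ω, hω, hA, hc, hl, hF, hc₀, hO, hc₁, hAS, hc₂, hAT, hAO, hflex⟩ :=
    hf₁.exists_hesseForm h3 hf₂ hx
  obtain ⟨A', l', c', c₀', c₁', c₂', ω', hω', hA', hc', -, hF', hc₀', hO', hc₁', hAS', hc₂', hAT',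
    -⟩ := hf₁'.exists_hesseForm h3 hf₂' hx'
  -- Preservation of the pairing makes the two triples of marked points coincide.
  obtain rfl : ω = ω' := by rw [hω, hω', hpair]
  obtain ⟨t₀, a, ha, ht₀⟩ := exists_hesseFibre (F := form W) h2 h3 hA hc hl
    (MvPolynomial.funext fun p => by rw [eval_subst, hF, map_mul, eval_C]) l'
  have hBdet : (A'⁻¹ * A).det ≠ 0 := by
    rw [Matrix.det_mul, Matrix.det_nonsing_inv, Ring.inverse_eq_inv']
    exact mul_ne_zero (inv_ne_zero hA') hA
  have heval (p : Fin 3 → K) : eval ((A'⁻¹ * A).mulVec p) (form W') =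
      c'⁻¹ * eval (A.mulVec p) (hesseForm l') := by
    rw [eq_inv_mul_iff_mul_eq₀ hc', ← hF', Matrix.mulVec_mulVec, ← mul_assoc,
      Matrix.mul_nonsing_inv _ hA'.isUnit, one_mul]
  have hmaps : subst (A'⁻¹ * A) (form W') = C (c'⁻¹ * a⁻¹) * hesseFibre (form W) t₀ := by
    refine MvPolynomial.funext fun p => ?_
    rw [eval_subst, heval, ht₀]
    simp only [map_mul, eval_C, eval_subst]
    field_simp
  have hca : c'⁻¹ * a⁻¹ ≠ 0 := mul_ne_zero (inv_ne_zero hc') (inv_ne_zero ha)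
  -- The Hesse cubics for l and l' differ by a multiple of XYZ, which vanishes on E[3].
  have hcurve (P : threeTorsion W) :
      eval ((A'⁻¹ * A).mulVec (coords P.1)) (form W') = 0 := by
    have hprod : A.mulVec (coords P.1) 0 * A.mulVec (coords P.1) 1 *
        A.mulVec (coords P.1) 2 = 0 := by
      by_cases hP : P = 0
      · rw [hP]
        change A.mulVec ![0, 1, 0] 0 * _ * _ = 0
        rw [hAO, zero_mul, zero_mul]
      · obtain ⟨x, y, m, hxy, hP, hm⟩ := exists_isFlex_of_ne_zero hP
        rw [hP]
        exact hflex x y m hm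
    have h0 := hF (coords P.1)
    rw [eval_form_coords, mul_zero, eval_hesseForm] at h0
    rw [heval, eval_hesseForm]
    linear_combination c'⁻¹ * h0 + 3 * (l - l') * c'⁻¹ * hprod
  refine ⟨t₀, Matrix.GeneralLinearGroup.mkOfDetNeZero (A'⁻¹ * A) hBdet,
    isSmooth_form.of_subst hBdet hmaps, ⟨_, hca, hmaps⟩, ?_⟩
  have key (P : threeTorsion W) : ∃ c : K, c ≠ 0 ∧
      (A'⁻¹ * A).mulVec (coords P.1) = c • coords (φ P).1 := by
    refine threeTorsion_induction (G := fun P => ∃ c : K, c ≠ 0 ∧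
      (A'⁻¹ * A).mulVec (coords P.1) = c • coords (φ P).1) h3 hS0 hT0 hST hST' ?_ ?_ ?_ ?_ P
    · rw [map_zero]
      exact mulVec_inv_mul_eq hA' hc₀ hc₀' hO hO'
    · rw [hφS]
      exact mulVec_inv_mul_eq hA' hc₁ hc₁' hAS hAS'
    · rw [hφT]
      exact mulVec_inv_mul_eq hA' hc₂ hc₂' hAT hAT'
    · exact fun P Q hPQ hP hQ => exists_mulVec_eq_neg_add hBdet φ hcurve hPQ hP hQ
  intro P
  obtain ⟨c, hc, h⟩ := key P
  rw [toPlane, toPlane, Projectivization.smul_mk, Projectivization.mk_eq_mk_iff']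
  exact ⟨c, h.symm⟩

end Main

theorem natCast_ne_zero_of_ringChar_ne {k K : Type*} [Field k] [Field K] [Algebra k K] {p : ℕ}
    (hp : p.Prime) (h : ringChar k ≠ p) : (p : K) ≠ 0 := by
  rw [← map_natCast (algebraMap k K), Ne, FaithfulSMul.algebraMap_eq_zero_iff, ringChar.spec]
  intro hd
  rcases (Nat.dvd_prime hp).1 hd with h1 | h1
  · exact CharP.ringChar_ne_one h1
  · exact h h1

end HessePencil

end

theorem proposition7p1 {k : Type*} [Field k] [PerfectField k]
    (h2 : ringChar k ≠ 2) (h3 : ringChar k ≠ 3)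
    [DecidableEq (AlgebraicClosure k)]
    (E E' : WeierstrassCurve k) [E.IsElliptic] [E'.IsElliptic]
    (φ : HessePencil.threeTorsion (E.baseChange (AlgebraicClosure k)) ≃+
      HessePencil.threeTorsion (E'.baseChange (AlgebraicClosure k)))
    (hφ : HessePencil.RespectsWeilPairings φ) :
    ∃ (t₀ : ℙ (AlgebraicClosure k) (Fin 2 → AlgebraicClosure k))
      (Φ : GL (Fin 3) (AlgebraicClosure k)),
      HessePencil.IsSmooth
        (HessePencil.hesseFibre (HessePencil.form (E.baseChange (AlgebraicClosure k))) t₀) ∧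
      HessePencil.MapsCurve Φ
        (HessePencil.hesseFibre (HessePencil.form (E.baseChange (AlgebraicClosure k))) t₀)
        (HessePencil.form (E'.baseChange (AlgebraicClosure k))) ∧
      ∀ P : HessePencil.threeTorsion (E.baseChange (AlgebraicClosure k)),
        Φ • HessePencil.toPlane P.1 =
          HessePencil.toPlane (φ P).1 := by
  have hE (E : WeierstrassCurve k) [E.IsElliptic] :
      (E.baseChange (AlgebraicClosure k)).IsElliptic :=
    inferInstanceAs (E.map (algebraMap k (AlgebraicClosure k))).IsElliptic
  have := hE E
  have := hE E'
  refine HessePencil.exists_hesseFibre_mapsCurve ?_ ?_ φ hφ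
  · exact_mod_cast HessePencil.natCast_ne_zero_of_ringChar_ne Nat.prime_two h2
  · exact_mod_cast HessePencil.natCast_ne_zero_of_ringChar_ne Nat.prime_three h3
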